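/- **Setting.** Let $\Lambda=\mathbb C[\lambda_{11},\lambda_{21},\lambda_{22},\lambda_{31},\lambda_{32},\lambda_{33}]$, with the conjugate-linear ring involution $\lambda_{ki}^*=\bar\lambda_{ki}=\zeta_{ki}-\lambda_{ki}$, where $\zeta_{21}=\zeta_{22}=1$ and the other $\zeta_{ki}$ are $0$, and with the shift automorphisms $\sigma_{ki}:\lambda_{ki}\mapsto\lambda_{ki}-1$. Put $r_{ki,mj}=\lambda_{ki}+\bar\lambda_{mj}$. Let $\mathfrak S\subset\Lambda$ be the multiplicative set generated by $\pm1$ and all integer shifts of $r_{11,21},r_{11,22},r_{21,22}$ and $r_{2i,3j}$ ($i=1,2$, $j=1,2,3$), and let $\mathbf L=\mathfrak S^{-1}\Lambda$. In $\mathbf L$ put $$t_{11}=r_{11,21}r_{11,22},\qquad t_{2i}=\frac{r_{2i,11}\prod_{k=1}^3 r_{2i,3k}}{r_{2i,2j}\,\sigma_{2i}(r_{2i,2j})}\quad(\{i,j\}=\{1,2\}),$$ $\mu_{ab}=\sigma_b^{-1}(t_a)/t_a$ for $a\ne b$ in $\{11,21,22\}$, and $\mu_{aa}=1$. Let $\mathfrak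 A$ be the associative $\mathbb C$-algebra generated by $\mathbf L$ and letters $x_a,y_a$ ($a\in\{11,21,22\}$) with the relations of $\mathbf L$ and $$x_af=\sigma_a(f)x_a,\quad y_af=\sigma_a^{-1}(f)y_a,\quad y_ax_a=t_a,\quad x_ay_a=\sigma_a(t_a),\quad x_ax_b=\mu_{ab}x_bx_a,\quad y_ay_b=\mu_{ab}^*\,y_by_a .$$ Let $\gamma_1=\lambda_{11}$, $\gamma_2=\lambda_{21}+\lambda_{22}-1$, and let $$\gamma_3^{(1)}=\lambda_{31}+\lambda_{32}+\lambda_{33},\qquad \gamma_3^{(2)}=\lambda_{31}\lambda_{32}+\lambda_{32}\lambda_{33}+\lambda_{31}\lambda_{33},\qquad \gamma_3^{(3)}=\lambda_{31}\lambda_{32}\lambda_{33}.$$ In $\mathfrak A$ put $X_1=x_{11}$, $Y_1=y_{11}$, $X_2=x_{21}+x_{22}$, $Y_2=y_{21}+y_{22}$, $X_3=[X_2,X_1]$, $Y_3=[Y_1,Y_2]$, $H_1=2\gamma_1-\gamma_2$, $H_2=2\gamma_2-\gamma_1-\gamma_3^{(1)}$, and $\mathcal U_k=X_k+Y_k$,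 $\mathcal V_k=i(Y_k-X_k)$, $\mathcal H_k=iH_k$ for $k=1,2$, $\mathcal U_3=Y_3-X_3$, $\mathcal V_3=i(Y_3+X_3)$. Let $\mathfrak g\subset\mathfrak A$ be the complex Lie subalgebra generated by $\mathcal U_k,\mathcal V_k$ ($k=1,2,3$) and $\mathcal H_1,\mathcal H_2$. Let $\mathfrak{su}(3;\mathbb C)$ be the Lie algebra of traceless complex $3\times3$ matrices, spanned by the Gell-Mann matrices $$\begin{gathered}F_1=E_{21}+E_{12},\quad F_2=i(E_{21}-E_{12}),\quad F_3=E_{11}-E_{22},\quad F_4=E_{31}+E_{13},\quad F_5=i(E_{31}-E_{13}),\\ F_6=E_{32}+E_{23},\quad F_7=i(E_{32}-E_{23}),\quad F_8=\tfrac1{\sqrt3}(E_{11}+E_{22}-2E_{33}).\end{gathered}$$ Let $d_{jkl}$ be the totally symmetric tensor with $d_{146}=d_{157}=-d_{247}=d_{256}=d_{344}=d_{355}=-d_{366}=-d_{377}=\frac12$, $d_{118}=d_{228}=d_{338}=-d_{888}=\frac1{\sqrt3}$, $d_{448}=d_{558}=d_{668}=d_{778}=-\frac1{2\sqrt3}$,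 all other independent values being $0$. In $U(\mathfrak{su}(3;\mathbb C))$ put $$C_2=\tfrac14\sum_kF_k^2,\qquad C_3=\tfrac18\sum_{j,k,l}d_{jkl}F_jF_kF_l,\qquad \widetilde C_3=\tfrac18\sum_{j,k,l}d_{jkl}(iF_j)(iF_k)(iF_l)=-i\,C_3 .$$ **Lemma.** The structure map $\mathbf L\to\mathfrak A$ is injective, and there is an isomorphism of complex Lie algebras $\varphi:\mathfrak{su}(3;\mathbb C)\to\mathfrak g$ that sends $$iF_1,\ iF_2,\ iF_3,\ iF_4,\ iF_5,\ iF_6,\ iF_7,\ iF_8\quad\text{to}\quad \mathcal U_1,\ \mathcal V_1,\ \mathcal H_1,\ \mathcal V_3,\ -\mathcal U_3,\ \mathcal U_2,\ \mathcal V_2,\ \tfrac1{\sqrt3}(\mathcal H_1+2\mathcal H_2).$$ The Casimir elements $C_2$ and $C_3$ lie in the center of $U(\mathfrak{su}(3;\mathbb C))$, and the algebra homomorphism $\psi:U(\mathfrak{su}(3;\mathbb C))\to\mathfrak A$ extending $\varphi$ satisfies $$\psi(C_2)=\tfrac13\Big(\big(\gamma_3^{(1)}\big)^2-3\gamma_3^{(2)}-3\Big),\qquad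 \psi(\widetilde C_3)=\tfrac{i}{18}\Big(9\gamma_3^{(2)}\gamma_3^{(1)}-2\big(\gamma_3^{(1)}\big)^3-27\gamma_3^{(3)}\Big),$$ equivalently, for the cubic element, $\psi(C_3)=\tfrac1{18}\Big(27\gamma_3^{(3)}-9\gamma_3^{(2)}\gamma_3^{(1)}+2\big(\gamma_3^{(1)}\big)^3\Big)$. -/

import Mathlib

/-! Associative rings carry the commutator bracket. -/
attribute [local instance 100] LieRing.ofAssociativeRing

/-! ### Rational twisted generalized Weyl algebras, by generators and relations -/

namespace RTGW

/-- Free generators: one for each coefficient `f ∈ L`, and the letters `x i`, `y i`. -/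
inductive Gen (L ι : Type) : Type
  | coeff (f : L) : Gen L ι
  | x (i : ι) : Gen L ι
  | y (i : ι) : Gen L ι

/-- Defining relations. The first four make `L` a `ℂ`-algebra inside the quotient; the others are
`x i f = σ i (f) x i`, `y i f = (σ i)⁻¹(f) y i`, `y i x i = t i`, `x i y i = σ i (t i)`,
`x i x j = μ i j x j x i`, and the image `y i y j = (μ i j)* y j y i` of the last one under
the involution. -/
inductive Rel {L ι : Type} [CommRing L] [Algebra ℂ L] (inv : L ≃+* L) (σ : ι → L ≃+* L)
    (t : ι → Lˣ) (μ : ι → ι → Lˣ) :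
    FreeAlgebra ℂ (Gen L ι) → FreeAlgebra ℂ (Gen L ι) → Prop
  | coeff_one : Rel inv σ t μ (FreeAlgebra.ι ℂ (Gen.coeff 1)) 1
  | coeff_smul (c : ℂ) (f : L) : Rel inv σ t μ
      (FreeAlgebra.ι ℂ (Gen.coeff (c • f))) (c • FreeAlgebra.ι ℂ (Gen.coeff f))
  | coeff_add (f g : L) : Rel inv σ t μ
      (FreeAlgebra.ι ℂ (Gen.coeff (f + g)))
      (FreeAlgebra.ι ℂ (Gen.coeff f) + FreeAlgebra.ι ℂ (Gen.coeff g))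
  | coeff_mul (f g : L) : Rel inv σ t μ
      (FreeAlgebra.ι ℂ (Gen.coeff (f * g)))
      (FreeAlgebra.ι ℂ (Gen.coeff f) * FreeAlgebra.ι ℂ (Gen.coeff g))
  | x_coeff (i : ι) (f : L) : Rel inv σ t μ
      (FreeAlgebra.ι ℂ (Gen.x i) * FreeAlgebra.ι ℂ (Gen.coeff f))
      (FreeAlgebra.ι ℂ (Gen.coeff (σ i f)) * FreeAlgebra.ι ℂ (Gen.x i))
  | y_coeff (i : ι) (f : L) : Rel inv σ t μ
      (FreeAlgebra.ι ℂ (Gen.y i) * FreeAlgebra.ι ℂ (Gen.coeff f))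
      (FreeAlgebra.ι ℂ (Gen.coeff ((σ i).symm f)) * FreeAlgebra.ι ℂ (Gen.y i))
  | y_x (i : ι) : Rel inv σ t μ
      (FreeAlgebra.ι ℂ (Gen.y i) * FreeAlgebra.ι ℂ (Gen.x i))
      (FreeAlgebra.ι ℂ (Gen.coeff (t i : L)))
  | x_y (i : ι) : Rel inv σ t μ
      (FreeAlgebra.ι ℂ (Gen.x i) * FreeAlgebra.ι ℂ (Gen.y i))
      (FreeAlgebra.ι ℂ (Gen.coeff (σ i (t i : L))))
  | x_x (i j : ι) : Rel inv σ t μ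
      (FreeAlgebra.ι ℂ (Gen.x i) * FreeAlgebra.ι ℂ (Gen.x j))
      (FreeAlgebra.ι ℂ (Gen.coeff (μ i j : L)) *
        (FreeAlgebra.ι ℂ (Gen.x j) * FreeAlgebra.ι ℂ (Gen.x i)))
  | y_y (i j : ι) : Rel inv σ t μ
      (FreeAlgebra.ι ℂ (Gen.y i) * FreeAlgebra.ι ℂ (Gen.y j))
      (FreeAlgebra.ι ℂ (Gen.coeff (inv (μ i j : L))) *
        (FreeAlgebra.ι ℂ (Gen.y j) * FreeAlgebra.ι ℂ (Gen.y i)))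

section Alg

variable {L ι : Type} [CommRing L] [Algebra ℂ L] (inv : L ≃+* L) (σ : ι → L ≃+* L)
  (t : ι → Lˣ) (μ : ι → ι → Lˣ)

/-- The algebra with coefficient ring `L`, involution `inv` of `L`, shifts `σ i`, and
parameters `t i`, `μ i j`. -/
abbrev Alg : Type := RingQuot (Rel inv σ t μ)

/-- The class of a free generator. -/
noncomputable def gen (g : Gen L ι) : Alg inv σ t μ :=
  RingQuot.mkAlgHom ℂ (Rel inv σ t μ) (FreeAlgebra.ι ℂ g)

/-- The structure homomorphism from the coefficient ring. -/
noncomputable def coeffHom : L →ₐ[ℂ] Alg inv σ t μ :=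
  AlgHom.ofLinearMap
    { toFun := fun f => gen inv σ t μ (Gen.coeff f)
      map_add' := fun f g => by
        simpa [gen] using RingQuot.mkAlgHom_rel ℂ (Rel.coeff_add (inv := inv) (σ := σ) (t := t)
          (μ := μ) f g)
      map_smul' := fun c f => by
        simpa [gen] using RingQuot.mkAlgHom_rel ℂ (Rel.coeff_smul (inv := inv) (σ := σ) (t := t)
          (μ := μ) c f) }
    (by simpa [gen] using RingQuot.mkAlgHom_rel ℂ (Rel.coeff_one (inv := inv) (σ := σ) (t := t)
          (μ := μ)))
    (fun f g => by
      simpa [gen] using RingQuot.mkAlgHom_rel ℂ (Rel.coeff_mul (inv := inv) (σ := σ) (t := t)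
          (μ := μ) f g))

end Alg

end RTGW

/-! ### The datum for `su(3)` -/

namespace SU3

open MvPolynomial

/-- The polynomial ring in the variables `λ₁₁, λ₂₁, λ₂₂, λ₃₁, λ₃₂, λ₃₃`, indexed in this order
by `0, …, 5`. -/
abbrev Lam : Type := MvPolynomial (Fin 6) ℂ

/-- The constants `ζ` of the involution: `1` for `λ₂₁, λ₂₂`, and `0` otherwise. -/
def zeta : Fin 6 → ℂ := ![0, 1, 1, 0, 0, 0]

/-- `λᵢ ↦ ζᵢ - λᵢ`, with complex conjugation on the scalars. -/
noncomputable def starHom : Lam →+* Lam :=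
  eval₂Hom ((C : ℂ →+* Lam).comp (starRingEnd ℂ)) (fun i => C (zeta i) - X i)

/-- The shift `λᵢ ↦ λᵢ - nᵢ`. -/
noncomputable def shiftHom (n : Fin 6 → ℤ) : Lam →ₐ[ℂ] Lam :=
  aeval (fun i => X i - C (n i : ℂ))

@[simp] theorem starHom_X (i : Fin 6) : starHom (X i) = C (zeta i) - X i := by
  simp [starHom]

@[simp] theorem starHom_C (c : ℂ) : starHom (C c) = C (starRingEnd ℂ c) := by
  simp [starHom]

@[simp] theorem shiftHom_X (n : Fin 6 → ℤ) (i : Fin 6) :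
    shiftHom n (X i) = X i - C (n i : ℂ) := by
  simp [shiftHom]

@[simp] theorem shiftHom_C (n : Fin 6 → ℤ) (c : ℂ) : shiftHom n (C c) = C c := by
  simp [shiftHom]

theorem conj_zeta (i : Fin 6) : starRingEnd ℂ (zeta i) = zeta i := by
  fin_cases i <;> simp [zeta]

theorem starHom_starHom (p : Lam) : starHom (starHom p) = p := by
  have h : starHom.comp starHom = RingHom.id Lam := by
    apply MvPolynomial.ringHom_ext
    · intro c; simp
    · intro i; simp [conj_zeta]
  exact congrArg (fun f : Lam →+* Lam => f p) h

theorem shiftHom_shiftHom (m n : Fin 6 → ℤ) (p : Lam) :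
    shiftHom m (shiftHom n p) = shiftHom (m + n) p := by
  have h : (shiftHom m).comp (shiftHom n) = shiftHom (m + n) := by
    apply MvPolynomial.algHom_ext
    intro i
    simp [sub_sub]
  exact congrArg (fun f : Lam →ₐ[ℂ] Lam => f p) h

theorem shiftHom_zero (p : Lam) : shiftHom 0 p = p := by
  have h : shiftHom 0 = AlgHom.id ℂ Lam := by
    apply MvPolynomial.algHom_ext
    intro i
    simp
  exact congrArg (fun f : Lam →ₐ[ℂ] Lam => f p) h

theorem starHom_shiftHom (n : Fin 6 → ℤ) (p : Lam) :
    starHom (shiftHom n p) = shiftHom (-n) (starHom p) := by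
  have h : starHom.comp (shiftHom n : Lam →+* Lam) =
      ((shiftHom (-n) : Lam →ₐ[ℂ] Lam) : Lam →+* Lam).comp starHom := by
    apply MvPolynomial.ringHom_ext
    · intro c; simp
    · intro i
      simp
      ring
  exact congrArg (fun f : Lam →+* Lam => f p) h

/-- The involution of the polynomial ring. -/
noncomputable def starEquiv : Lam ≃+* Lam :=
  RingEquiv.ofRingHom starHom starHom
    (RingHom.ext starHom_starHom) (RingHom.ext starHom_starHom)

/-- The shift automorphism `λᵢ ↦ λᵢ - nᵢ` of the polynomial ring. -/
noncomputable def shiftEquiv (n : Fin 6 → ℤ) : Lam ≃+* Lam :=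
  RingEquiv.ofRingHom (shiftHom n) (shiftHom (-n))
    (RingHom.ext fun p => by simp [shiftHom_shiftHom, shiftHom_zero])
    (RingHom.ext fun p => by simp [shiftHom_shiftHom, shiftHom_zero])

/-- `r a b = λ_a + (λ_b)*`. -/
noncomputable def r (a b : Fin 6) : Lam := X a + starHom (X b)

/-- The generating set `{r₁₁,₂₁, r₁₁,₂₂, r₂₁,₂₂} ∪ {r₂ᵢ,₃ⱼ}`. -/
def Omega : Set Lam :=
  {r 0 1, r 0 2, r 1 2, r 1 3, r 1 4, r 1 5, r 2 3, r 2 4, r 2 5}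

/-- The multiplicative closure of `±1` and of all shifts of the elements of `Omega`. -/
noncomputable def S : Submonoid Lam :=
  Submonoid.closure ({p | ∃ n : Fin 6 → ℤ, ∃ w ∈ Omega, p = shiftHom n w} ∪ {1, -1})

theorem neg_mem_S {p : Lam} (hp : p ∈ S) : -p ∈ S := by
  have h : (-1 : Lam) ∈ S := Submonoid.subset_closure (by simp)
  simpa using S.mul_mem h hp

theorem shift_Omega_mem_S (n : Fin 6 → ℤ) {w : Lam} (hw : w ∈ Omega) : shiftHom n w ∈ S :=
  Submonoid.subset_closure (Or.inl ⟨n, w, hw, rfl⟩)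

theorem shift_mem_S (n : Fin 6 → ℤ) {p : Lam} (hp : p ∈ S) : shiftHom n p ∈ S := by
  refine Submonoid.closure_induction (motive := fun q _ => shiftHom n q ∈ S) ?_ ?_ ?_ hp
  · rintro q (⟨m, w, hw, rfl⟩ | rfl | rfl)
    · rw [shiftHom_shiftHom]
      exact shift_Omega_mem_S _ hw
    · rw [map_one]
      exact S.one_mem
    · rw [map_neg, map_one]
      exact neg_mem_S S.one_mem
  · rw [map_one]
    exact S.one_mem
  · intro a b _ _ ha hb
    rw [map_mul]
    exact S.mul_mem ha hb

/-- The one step shift `λ_a ↦ λ_a - 1` as an integer vector. -/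
def e (a : Fin 6) : Fin 6 → ℤ := Pi.single a 1

theorem r_neg_one {a b : Fin 6} (hab : a ≠ b) (h : zeta a + zeta b = 1) :
    r b a = - shiftHom (e a) (r a b) := by
  have hC : (C (zeta a) : Lam) + C (zeta b) = 1 := by rw [← C_add, h, C_1]
  simp [r, e, hab.symm]
  linear_combination hC

theorem star_r (a b : Fin 6) : starHom (r a b) = r b a := by
  simp [r, conj_zeta]
  ring

theorem r_mem_S {a b : Fin 6} (h : r a b ∈ Omega) : r a b ∈ S := by
  simpa [shiftHom_zero] using shift_Omega_mem_S 0 h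

theorem r_swap_mem_S {a b : Fin 6} (hr : r a b ∈ Omega) (hab : a ≠ b)
    (h : zeta a + zeta b = 1) : r b a ∈ S := by
  rw [r_neg_one hab h]
  exact neg_mem_S (shift_Omega_mem_S _ hr)

theorem r21_mem_S : r 2 1 ∈ S := by
  have h : r 2 1 = - shiftHom (2 • e 1) (r 1 2) := by
    simp [r, e, zeta]
    ring_nf
    rw [show (C (2 : ℂ) : Lam) = 2 from rfl]
    ring
  rw [h]
  exact neg_mem_S (shift_Omega_mem_S _ (by simp [Omega]))

theorem star_Omega_mem_S {w : Lam} (hw : w ∈ Omega) : starHom w ∈ S := by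
  have hw' := hw
  simp only [Omega, Set.mem_insert_iff, Set.mem_singleton_iff] at hw'
  rcases hw' with h | h | h | h | h | h | h | h | h
  case inr.inr.inl =>
    rw [h, star_r]; exact r21_mem_S
  all_goals
    subst h
    rw [star_r]
    exact r_swap_mem_S hw (by decide) (by simp [zeta])

theorem star_mem_S {p : Lam} (hp : p ∈ S) : starHom p ∈ S := by
  refine Submonoid.closure_induction (motive := fun q _ => starHom q ∈ S) ?_ ?_ ?_ hp
  · rintro q (⟨m, w, hw, rfl⟩ | rfl | rfl)
    · rw [starHom_shiftHom]
      exact shift_mem_S _ (star_Omega_mem_S hw)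
    · rw [map_one]
      exact S.one_mem
    · rw [map_neg, map_one]
      exact neg_mem_S S.one_mem
  · rw [map_one]
    exact S.one_mem
  · intro a b _ _ ha hb
    rw [map_mul]
    exact S.mul_mem ha hb

theorem map_star_S : S.map (starEquiv : Lam ≃+* Lam).toMonoidHom = S := by
  apply le_antisymm
  · rintro _ ⟨p, hp, rfl⟩
    exact star_mem_S hp
  · intro p hp
    exact ⟨starHom p, star_mem_S hp, starHom_starHom p⟩

theorem map_shift_S (n : Fin 6 → ℤ) : S.map (shiftEquiv n).toMonoidHom = S := by
  apply le_antisymm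
  · rintro _ ⟨p, hp, rfl⟩
    exact shift_mem_S n hp
  · intro p hp
    refine ⟨shiftHom (-n) p, shift_mem_S _ hp, ?_⟩
    change shiftHom n (shiftHom (-n) p) = p
    simp [shiftHom_shiftHom, shiftHom_zero]

/-- The localized coefficient ring `S⁻¹Λ`. -/
abbrev LL : Type := Localization S

/-- The involution of the localized ring. -/
noncomputable def star : LL ≃+* LL :=
  IsLocalization.ringEquivOfRingEquiv LL LL starEquiv map_star_S

/-- The shift of the localized ring by the integer vector `n`. -/
noncomputable def shift (n : Fin 6 → ℤ) : LL ≃+* LL :=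
  IsLocalization.ringEquivOfRingEquiv LL LL (shiftEquiv n) (map_shift_S n)

/-- An element of `S` as a unit of the localized ring. -/
noncomputable def unitOf (p : Lam) (hp : p ∈ S) : LLˣ :=
  (IsLocalization.map_units LL (⟨p, hp⟩ : S)).unit

/-- The indices `11, 21, 22` among all indices. -/
def idx : Fin 3 → Fin 6 := ![0, 1, 2]

/-- The one step shifts `σ₁₁, σ₂₁, σ₂₂`. -/
noncomputable def sigma (i : Fin 3) : LL ≃+* LL := shift (e (idx i))

/-- The parameters `t₁₁ = r₁₁,₂₁ r₁₁,₂₂` and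
`t₂ᵢ = r₂ᵢ,₁₁ r₂ᵢ,₃₁ r₂ᵢ,₃₂ r₂ᵢ,₃₃ / (r₂ᵢ,₂ⱼ σ₂ᵢ(r₂ᵢ,₂ⱼ))`, `{i, j} = {1, 2}`. -/
noncomputable def t : Fin 3 → LLˣ :=
  ![unitOf (r 0 1) (r_mem_S (by simp [Omega])) * unitOf (r 0 2) (r_mem_S (by simp [Omega])),
    unitOf (r 1 0) (r_swap_mem_S (a := 0) (by simp [Omega]) (by decide) (by simp [zeta])) *
      (unitOf (r 1 3) (r_mem_S (by simp [Omega])) * unitOf (r 1 4) (r_mem_S (by simp [Omega])) *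
        unitOf (r 1 5) (r_mem_S (by simp [Omega]))) /
      (unitOf (r 1 2) (r_mem_S (by simp [Omega])) *
        Units.map (sigma 1 : LL →* LL) (unitOf (r 1 2) (r_mem_S (by simp [Omega])))),
    unitOf (r 2 0) (r_swap_mem_S (a := 0) (by simp [Omega]) (by decide) (by simp [zeta])) *
      (unitOf (r 2 3) (r_mem_S (by simp [Omega])) * unitOf (r 2 4) (r_mem_S (by simp [Omega])) *
        unitOf (r 2 5) (r_mem_S (by simp [Omega]))) /
      (unitOf (r 2 1) r21_mem_S * Units.map (sigma 2 : LL →* LL) (unitOf (r 2 1) r21_mem_S))]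

/-- The parameters `μᵢⱼ = σⱼ⁻¹(tᵢ) / tᵢ` for `i ≠ j`, and `μᵢᵢ = 1`. -/
noncomputable def mu (i j : Fin 3) : LLˣ :=
  if i = j then 1 else Units.map ((sigma j).symm : LL →* LL) (t i) / t i

/-- The algebra `𝔄`. -/
abbrev A : Type := RTGW.Alg star sigma t mu

/-- The structure homomorphism `S⁻¹Λ → 𝔄`. -/
noncomputable def rho : LL →ₐ[ℂ] A := RTGW.coeffHom star sigma t mu

/-- The image in `𝔄` of a polynomial. -/
noncomputable def poly (p : Lam) : A := rho (algebraMap Lam LL p)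

/-- The generators `x₁₁, x₂₁, x₂₂` of `𝔄`. -/
noncomputable def x (i : Fin 3) : A := RTGW.gen star sigma t mu (RTGW.Gen.x i)

/-- The generators `y₁₁, y₂₁, y₂₂` of `𝔄`. -/
noncomputable def y (i : Fin 3) : A := RTGW.gen star sigma t mu (RTGW.Gen.y i)

/-! The symmetric polynomials. -/

/-- `γ₁ = λ₁₁`. -/
noncomputable def gamma1 : Lam := X 0

/-- `γ₂ = λ₂₁ + λ₂₂ - 1`. -/
noncomputable def gamma2 : Lam := X 1 + X 2 - 1

/-- `γ₃⁽¹⁾ = λ₃₁ + λ₃₂ + λ₃₃`. -/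
noncomputable def gamma31 : Lam := X 3 + X 4 + X 5

/-- `γ₃⁽²⁾ = λ₃₁λ₃₂ + λ₃₂λ₃₃ + λ₃₁λ₃₃`. -/
noncomputable def gamma32 : Lam := X 3 * X 4 + X 4 * X 5 + X 3 * X 5

/-- `γ₃⁽³⁾ = λ₃₁λ₃₂λ₃₃`. -/
noncomputable def gamma33 : Lam := X 3 * X 4 * X 5

/-! The elements of `𝔄` that span the copy of the Lie algebra. -/

noncomputable def X1 : A := x 0
noncomputable def Y1 : A := y 0
noncomputable def X2 : A := x 1 + x 2
noncomputable def Y2 : A := y 1 + y 2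
noncomputable def X3 : A := ⁅X2, X1⁆
noncomputable def Y3 : A := ⁅Y1, Y2⁆
noncomputable def H1 : A := poly (2 * gamma1 - gamma2)
noncomputable def H2 : A := poly (2 * gamma2 - gamma1 - gamma31)

noncomputable def U1 : A := X1 + Y1
noncomputable def V1 : A := Complex.I • (Y1 - X1)
noncomputable def iH1 : A := Complex.I • H1
noncomputable def U2 : A := X2 + Y2
noncomputable def V2 : A := Complex.I • (Y2 - X2)
noncomputable def iH2 : A := Complex.I • H2
noncomputable def U3 : A := Y3 - X3
noncomputable def V3 : A := Complex.I • (Y3 + X3)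

/-- The elements of `𝔄` that correspond to `iF₁, …, iF₈`. -/
noncomputable def T : Fin 8 → A :=
  ![U1, V1, iH1, V3, -U3, U2, V2, ((1 / Real.sqrt 3 : ℝ) : ℂ) • (iH1 + (2 : ℂ) • iH2)]

/-- The Lie subalgebra of `𝔄` generated by these elements. -/
noncomputable def gsu : LieSubalgebra ℂ A := LieSubalgebra.lieSpan ℂ A (Set.range T)

/-! ### Gell-Mann matrices and Casimir elements -/

/-- The complex Lie algebra `su(3; ℂ)`, i.e. the traceless complex `3 × 3` matrices. -/
abbrev sl3 : Type := LieAlgebra.SpecialLinear.sl (Fin 3) ℂ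

/-- The Gell-Mann matrices `F₁, …, F₈`, indexed by `0, …, 7`. -/
noncomputable def gellMannMatrix : Fin 8 → Matrix (Fin 3) (Fin 3) ℂ :=
  ![!![0, 1, 0; 1, 0, 0; 0, 0, 0],
    !![0, -Complex.I, 0; Complex.I, 0, 0; 0, 0, 0],
    !![1, 0, 0; 0, -1, 0; 0, 0, 0],
    !![0, 0, 1; 0, 0, 0; 1, 0, 0],
    !![0, 0, -Complex.I; 0, 0, 0; Complex.I, 0, 0],
    !![0, 0, 0; 0, 0, 1; 0, 1, 0],
    !![0, 0, 0; 0, 0, -Complex.I; 0, Complex.I, 0],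
    ((1 / Real.sqrt 3 : ℝ) : ℂ) • !![1, 0, 0; 0, 1, 0; 0, 0, -2]]

/-- The Gell-Mann matrices as elements of the Lie algebra. -/
noncomputable def F (k : Fin 8) : sl3 :=
  ⟨gellMannMatrix k, by
    rw [LieAlgebra.SpecialLinear.sl, LieSubalgebra.mem_mk_iff', LinearMap.mem_ker]
    fin_cases k <;> simp [gellMannMatrix, Matrix.trace_fin_three]
    ring⟩

/-- The values of the symmetric tensor `d` at the independent index triples (with the customary
numbering `1, …, 8`); all other values are zero. -/
noncomputable def dIndep : ℕ → ℕ → ℕ → ℝ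
  | 1, 4, 6 => 1 / 2
  | 1, 5, 7 => 1 / 2
  | 2, 4, 7 => -1 / 2
  | 2, 5, 6 => 1 / 2
  | 3, 4, 4 => 1 / 2
  | 3, 5, 5 => 1 / 2
  | 3, 6, 6 => -1 / 2
  | 3, 7, 7 => -1 / 2
  | 1, 1, 8 => 1 / Real.sqrt 3
  | 2, 2, 8 => 1 / Real.sqrt 3
  | 3, 3, 8 => 1 / Real.sqrt 3
  | 8, 8, 8 => -1 / Real.sqrt 3
  | 4, 4, 8 => -1 / (2 * Real.sqrt 3)
  | 5, 5, 8 => -1 / (2 * Real.sqrt 3)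
  | 6, 6, 8 => -1 / (2 * Real.sqrt 3)
  | 7, 7, 8 => -1 / (2 * Real.sqrt 3)
  | _, _, _ => 0

/-- The totally symmetric tensor `d`: sort the three indices and look up the value. -/
noncomputable def d (j k l : Fin 8) : ℂ :=
  ((dIndep (min j (min k l) + 1 : ℕ) (max (min j k) (min (max j k) l) + 1 : ℕ)
    (max j (max k l) + 1 : ℕ) : ℝ) : ℂ)

/-- The universal enveloping algebra of `su(3; ℂ)`. -/
abbrev U : Type := UniversalEnvelopingAlgebra ℂ sl3

/-- The inclusion of the Lie algebra in its enveloping algebra. -/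
noncomputable def toU : sl3 →ₗ⁅ℂ⁆ U := UniversalEnvelopingAlgebra.ι ℂ

/-- `¼ ∑ f_k f_k`. -/
noncomputable def quadratic (f : Fin 8 → sl3) : U :=
  (1 / 4 : ℂ) • ∑ k, toU (f k) * toU (f k)

/-- `⅛ ∑ d_{jkl} f_j f_k f_l`. -/
noncomputable def cubic (f : Fin 8 → sl3) : U :=
  (1 / 8 : ℂ) • ∑ j, ∑ k, ∑ l, d j k l • (toU (f j) * toU (f k) * toU (f l))

/-- The algebra homomorphism `U(su(3; ℂ)) → 𝔄` that extends an isomorphism onto the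
Lie subalgebra `gsu`. -/
noncomputable def extend (φ : sl3 ≃ₗ⁅ℂ⁆ gsu) : U →ₐ[ℂ] A :=
  UniversalEnvelopingAlgebra.lift ℂ (gsu.incl.comp (φ : sl3 →ₗ⁅ℂ⁆ gsu))

end SU3

/-! ### The coefficient ring and its field of fractions -/

namespace SU3

open MvPolynomial

/-! After a change of gauge, 𝔄 can be treated as an algebra of shift operators. There are units pᵢ =
`gaugeX i` and qᵢ = `gaugeY i` of 𝐋 such that xᵢ = pᵢsᵢ and yᵢ = qᵢsᵢ⁻¹, where the sᵢ are
invertible, commute with one another and induce σᵢ on coefficients. The same formulas let 𝔄 act on 𝐋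
by f, pᵢσᵢ and qᵢσᵢ⁻¹. Applying the image of f to 1 returns f, so 𝐋 → 𝔄 is injective
(`rho_injective`). Coefficients times monomials in the sᵢ multiply by one rule
(`smul_mon_mul_smul_mon`). Hence an identity in 𝔄 follows once the coefficients agree, and these are
rational functions that can be compared in the field of fractions.

The elements γ₁, γ₂ - γ₁, γ₃⁽¹⁾ - γ₂ on the diagonal and suitable multiples of the Xₖ, Yₖ off it
form a 3 × 3 matrix E = `glE` whose entries satisfy the gl₃ relations (`lie_glE`). Restricting the
resulting homomorphism to traceless matrices gives `toA`. It is injective because the diagonal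
entries of E are distinct, and its range is `gsu` because the Gell-Mann matrices span.

For the matrix m of traceless generators, C₂ = ½ tr m² and C₃ = ½ tr m³ - ¾ tr m², the last term
coming from the order of factors. Traces of powers of m commute with every entry of m, which gives
centrality. Under ψ, m becomes E - ⅓ tr E with tr E = γ₃⁽¹⁾ central, so it remains to find tr E² and
tr E³. Moving E₃ᵢ to the left of Eᵢ₃ reduces them to the upper 2 × 2 block and to W = ∑ E₃ᵢEᵢ₃, V =
∑ E₃ᵢEᵢⱼEⱼ₃ with i, j ≤ 2. With g(u) = ∏(u - λ₃ₖ), W and V are minus the divided differences at λ₂₁,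
λ₂₂ of g(u) and (u + 1)g(u). In the total, λ₁₁, λ₂₁ and λ₂₂ cancel. -/

theorem shiftHom_injective (n : Fin 6 → ℤ) : Function.Injective (shiftHom n) :=
  (shiftEquiv n).injective

theorem Omega_ne_zero {w : Lam} (hw : w ∈ Omega) : w ≠ 0 := by
  have key : ∀ a b : Fin 6, a ≠ b → r a b ≠ 0 := by
    intro a b hab h
    -- The values of λ_a - λ_b + const at the basis vector of a and at 0 differ by 1, so both cannot
    -- vanish.
    have h1 := congrArg (eval (Pi.single a (1 : ℂ))) h
    have h2 := congrArg (eval (0 : Fin 6 → ℂ)) h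
    simp only [r, starHom_X, map_add, map_sub, eval_X, eval_C, Pi.single_eq_same,
      Pi.single_eq_of_ne hab.symm, Pi.zero_apply, map_zero, zero_add, sub_zero] at h1 h2
    simp [h2] at h1
  simp only [Omega, Set.mem_insert_iff, Set.mem_singleton_iff] at hw
  rcases hw with h | h | h | h | h | h | h | h | h <;> subst h <;> exact key _ _ (by decide)

theorem S_le_nonZeroDivisors : S ≤ nonZeroDivisors Lam := by
  rw [S, Submonoid.closure_le]
  rintro p (⟨n, w, hw, rfl⟩ | rfl | rfl) <;> refine mem_nonZeroDivisors_of_ne_zero ?_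
  · rw [Ne, map_eq_zero_iff _ (shiftHom_injective n)]
    exact Omega_ne_zero hw
  · exact one_ne_zero
  · exact neg_ne_zero.mpr one_ne_zero

instance : IsDomain LL := IsLocalization.isDomain_localization S_le_nonZeroDivisors

theorem algebraMap_LL_injective : Function.Injective (algebraMap Lam LL) :=
  IsLocalization.injective LL S_le_nonZeroDivisors

theorem shift_algebraMap (n : Fin 6 → ℤ) (p : Lam) :
    shift n (algebraMap Lam LL p) = algebraMap Lam LL (shiftHom n p) :=
  IsLocalization.ringEquivOfRingEquiv_eq (map_shift_S n) p

theorem star_algebraMap (p : Lam) :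
    star (algebraMap Lam LL p) = algebraMap Lam LL (starHom p) :=
  IsLocalization.ringEquivOfRingEquiv_eq map_star_S p

theorem shift_shift (m n : Fin 6 → ℤ) (f : LL) : shift m (shift n f) = shift (m + n) f := by
  have h : (shift m : LL →+* LL).comp (shift n : LL →+* LL) = (shift (m + n) : LL →+* LL) := by
    refine IsLocalization.ringHom_ext S (RingHom.ext fun p => ?_)
    simp [shift_algebraMap, shiftHom_shiftHom]
  exact congrArg (fun g : LL →+* LL => g f) h

theorem shift_zero (f : LL) : shift 0 f = f := by
  have h : (shift 0 : LL →+* LL) = RingHom.id LL := by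
    refine IsLocalization.ringHom_ext S (RingHom.ext fun p => ?_)
    simp [shift_algebraMap, shiftHom_zero]
  exact congrArg (fun g : LL →+* LL => g f) h

theorem shift_symm (n : Fin 6 → ℤ) (f : LL) : (shift n).symm f = shift (-n) f := by
  rw [RingEquiv.symm_apply_eq, shift_shift, add_neg_cancel, shift_zero]

theorem algebraMap_complex_LL (c : ℂ) : algebraMap ℂ LL c = algebraMap Lam LL (C c) := by
  rw [IsScalarTower.algebraMap_apply ℂ Lam LL, algebraMap_eq]

theorem shift_algebraMap_complex (n : Fin 6 → ℤ) (c : ℂ) :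
    shift n (algebraMap ℂ LL c) = algebraMap ℂ LL c := by
  rw [algebraMap_complex_LL, shift_algebraMap, shiftHom_C]

theorem shift_smul (n : Fin 6 → ℤ) (c : ℂ) (f : LL) : shift n (c • f) = c • shift n f := by
  rw [Algebra.smul_def, map_mul, shift_algebraMap_complex, Algebra.smul_def]

/-- The field of fractions of the coefficient ring. -/
def KK : Type := FractionRing LL

noncomputable instance : Field KK := inferInstanceAs (Field (FractionRing LL))
noncomputable instance : Algebra LL KK := inferInstanceAs (Algebra LL (FractionRing LL))
instance : IsFractionRing LL KK := inferInstanceAs (IsFractionRing LL (FractionRing LL))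

/-- The embedding of the coefficient ring in its field of fractions. -/
noncomputable def toKK : LL →+* KK := algebraMap LL KK

theorem toKK_injective : Function.Injective toKK := IsFractionRing.injective LL KK

instance : CharZero KK :=
  ((toKK.comp ((algebraMap Lam LL).comp C)).charZero_iff (RingHom.injective _)).mp inferInstance

/-- The extension of an automorphism of the coefficient ring to the field of fractions. -/
noncomputable def extKK (φ : LL ≃+* LL) : KK ≃+* KK := IsFractionRing.ringEquivOfRingEquiv φ

theorem toKK_apply (φ : LL ≃+* LL) (f : LL) : toKK (φ f) = extKK φ (toKK f) :=
  (IsFractionRing.ringEquivOfRingEquiv_algebraMap φ f).symm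

theorem toKK_unit_inv (u : LLˣ) : toKK ((u⁻¹ : LLˣ) : LL) = (toKK (u : LL))⁻¹ := by
  refine eq_inv_of_mul_eq_one_left ?_
  rw [← map_mul, Units.inv_mul, map_one]

theorem toKK_unit_div (u v : LLˣ) :
    toKK ((u / v : LLˣ) : LL) = toKK (u : LL) / toKK (v : LL) := by
  rw [div_eq_mul_inv, Units.val_mul, map_mul, toKK_unit_inv, div_eq_mul_inv]

/-- The variable `λᵢ` in the coefficient ring. -/
noncomputable def lam (i : Fin 6) : LL := algebraMap Lam LL (X i)

/-- The variable `λᵢ` in the field of fractions. -/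
noncomputable def lamK (i : Fin 6) : KK := toKK (lam i)

theorem toKK_lam (i : Fin 6) : toKK (lam i) = lamK i := rfl

theorem shift_lam (n : Fin 6 → ℤ) (i : Fin 6) : shift n (lam i) = lam i - (n i : LL) := by
  simp [lam, shift_algebraMap]

theorem star_lam (i : Fin 6) : star (lam i) = algebraMap ℂ LL (zeta i) - lam i := by
  simp [lam, star_algebraMap, algebraMap_complex_LL]

theorem extKK_shift_lamK (n : Fin 6 → ℤ) (i : Fin 6) :
    extKK (shift n) (lamK i) = lamK i - (n i : KK) := by
  simp [lamK, ← toKK_apply, shift_lam]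

theorem extKK_star_lamK (i : Fin 6) :
    extKK star (lamK i) = toKK (algebraMap ℂ LL (zeta i)) - lamK i := by
  simp [lamK, ← toKK_apply, star_lam]

theorem coe_unitOf (p : Lam) (hp : p ∈ S) : (unitOf p hp : LL) = algebraMap Lam LL p := rfl

theorem algebraMap_r (a b : Fin 6) :
    algebraMap Lam LL (r a b) = lam a + algebraMap ℂ LL (zeta b) - lam b := by
  simp [r, lam, algebraMap_complex_LL]
  ring

theorem lamK_sub_ne_zero {a b : Fin 6} (hab : a ≠ b) (n : ℂ) :
    lamK a - lamK b + toKK (algebraMap ℂ LL n) ≠ 0 := by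
  rw [lamK, lamK, ← map_sub, ← map_add, Ne, map_eq_zero_iff _ toKK_injective, lam, lam,
    algebraMap_complex_LL, ← map_sub, ← map_add, map_eq_zero_iff _ algebraMap_LL_injective]
  intro h
  have h1 := congrArg (eval (Pi.single a (1 : ℂ))) h
  have h2 := congrArg (eval (0 : Fin 6 → ℂ)) h
  simp only [map_add, map_sub, eval_X, eval_C, Pi.single_eq_same,
      Pi.single_eq_of_ne hab.symm, Pi.zero_apply, map_zero, zero_add, sub_zero] at h1 h2
  simp [h2] at h1

theorem lamK_sub_add_intCast_ne_zero {a b : Fin 6} (hab : a ≠ b) (n : ℤ) :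
    lamK a - lamK b + n ≠ 0 := by
  simpa using lamK_sub_ne_zero hab n

/-! ### Explicit values of the parameters in the field of fractions -/

theorem toKK_t_zero :
    toKK (t 0 : LL) = (lamK 0 - lamK 1 + 1) * (lamK 0 - lamK 2 + 1) := by
  simp [t, coe_unitOf, algebraMap_r, toKK_lam, zeta]
  ring

theorem toKK_t_one :
    toKK (t 1 : LL) = (lamK 1 - lamK 0) * ((lamK 1 - lamK 3) * (lamK 1 - lamK 4) *
      (lamK 1 - lamK 5)) / ((lamK 1 - lamK 2 + 1) * (lamK 1 - lamK 2)) := by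
  simp [t, toKK_unit_div, coe_unitOf, algebraMap_r, toKK_lam, zeta, sigma, e, idx, shift_lam,
    add_sub_right_comm]
  congr 2
  ring

theorem toKK_t_two :
    toKK (t 2 : LL) = (lamK 2 - lamK 0) * ((lamK 2 - lamK 3) * (lamK 2 - lamK 4) *
      (lamK 2 - lamK 5)) / ((lamK 2 - lamK 1 + 1) * (lamK 2 - lamK 1)) := by
  simp [t, toKK_unit_div, coe_unitOf, algebraMap_r, toKK_lam, zeta, sigma, e, idx, shift_lam,
    add_sub_right_comm]
  congr 2
  ring

theorem toKK_mu {i j : Fin 3} (hij : i ≠ j) :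
    toKK (mu i j : LL) = extKK (shift (-e (idx j))) (toKK (t i : LL)) / toKK (t i : LL) := by
  rw [mu, if_neg hij, toKK_unit_div]
  simp [sigma, shift_symm, ← toKK_apply]

open MvPolynomial

theorem lamK_sub_ne {a b : Fin 6} (hab : a ≠ b) : lamK a - lamK b ≠ 0 := by
  simpa using lamK_sub_add_intCast_ne_zero hab 0

theorem lamK_sub_add_one_ne {a b : Fin 6} (hab : a ≠ b) : lamK a - lamK b + 1 ≠ 0 := by
  simpa using lamK_sub_add_intCast_ne_zero hab 1

theorem lamK_sub_sub_one_ne {a b : Fin 6} (hab : a ≠ b) : lamK a - lamK b - 1 ≠ 0 := by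
  simpa [sub_eq_add_neg] using lamK_sub_add_intCast_ne_zero hab (-1)

/-- In the quotient of a shifted tᵢ by tᵢ, every factor without λⱼ cancels; the other five values
arise in the same way. -/
theorem toKK_mu_zero_one :
    toKK (mu 0 1 : LL) = (lamK 0 - lamK 1) / (lamK 0 - lamK 1 + 1) := by
  have h2 : lamK 0 - lamK 2 + 1 ≠ 0 := lamK_sub_add_one_ne (by decide)
  rw [toKK_mu (by decide), toKK_t_zero]
  simp [extKK_shift_lamK, e, idx]
  rw [mul_div_mul_right _ _ h2]
  ring

theorem toKK_mu_zero_two :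
    toKK (mu 0 2 : LL) = (lamK 0 - lamK 2) / (lamK 0 - lamK 2 + 1) := by
  have h2 : lamK 0 - lamK 1 + 1 ≠ 0 := lamK_sub_add_one_ne (by decide)
  rw [toKK_mu (by decide), toKK_t_zero]
  simp [extKK_shift_lamK, e, idx]
  rw [mul_div_mul_left _ _ h2]
  ring

theorem toKK_mu_one_zero :
    toKK (mu 1 0 : LL) = (lamK 1 - lamK 0 - 1) / (lamK 1 - lamK 0) := by
  have h : ∀ {a b : Fin 6}, a ≠ b → lamK a - lamK b ≠ 0 := lamK_sub_ne
  have h0 := h (show (1 : Fin 6) ≠ 0 by decide)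
  have h2 := h (show (1 : Fin 6) ≠ 2 by decide)
  have h3 := h (show (1 : Fin 6) ≠ 3 by decide)
  have h4 := h (show (1 : Fin 6) ≠ 4 by decide)
  have h5 := h (show (1 : Fin 6) ≠ 5 by decide)
  have h6 : lamK 1 - lamK 2 + 1 ≠ 0 := lamK_sub_add_one_ne (by decide)
  rw [toKK_mu (by decide), toKK_t_one]
  simp [extKK_shift_lamK, e, idx]
  field_simp
  ring

theorem toKK_mu_two_zero :
    toKK (mu 2 0 : LL) = (lamK 2 - lamK 0 - 1) / (lamK 2 - lamK 0) := by
  have h : ∀ {a b : Fin 6}, a ≠ b → lamK a - lamK b ≠ 0 := lamK_sub_ne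
  have h0 := h (show (2 : Fin 6) ≠ 0 by decide)
  have h2 := h (show (2 : Fin 6) ≠ 1 by decide)
  have h3 := h (show (2 : Fin 6) ≠ 3 by decide)
  have h4 := h (show (2 : Fin 6) ≠ 4 by decide)
  have h5 := h (show (2 : Fin 6) ≠ 5 by decide)
  have h6 : lamK 2 - lamK 1 + 1 ≠ 0 := lamK_sub_add_one_ne (by decide)
  rw [toKK_mu (by decide), toKK_t_two]
  simp [extKK_shift_lamK, e, idx]
  field_simp
  ring

theorem toKK_mu_one_two :
    toKK (mu 1 2 : LL) = (lamK 1 - lamK 2 + 1) / (lamK 1 - lamK 2 - 1) := by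
  have h : ∀ {a b : Fin 6}, a ≠ b → lamK a - lamK b ≠ 0 := lamK_sub_ne
  have h0 := h (show (1 : Fin 6) ≠ 0 by decide)
  have h2 := h (show (1 : Fin 6) ≠ 2 by decide)
  have h3 := h (show (1 : Fin 6) ≠ 3 by decide)
  have h4 := h (show (1 : Fin 6) ≠ 4 by decide)
  have h5 := h (show (1 : Fin 6) ≠ 5 by decide)
  have h6 : lamK 1 - lamK 2 + 1 ≠ 0 := lamK_sub_add_one_ne (by decide)
  have h7 : lamK 1 - lamK 2 - 1 ≠ 0 := lamK_sub_sub_one_ne (by decide)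
  rw [toKK_mu (by decide), toKK_t_one]
  simp [extKK_shift_lamK, e, idx, sub_add_eq_sub_sub]
  field_simp

theorem toKK_mu_two_one :
    toKK (mu 2 1 : LL) = (lamK 2 - lamK 1 + 1) / (lamK 2 - lamK 1 - 1) := by
  have h : ∀ {a b : Fin 6}, a ≠ b → lamK a - lamK b ≠ 0 := lamK_sub_ne
  have h0 := h (show (2 : Fin 6) ≠ 0 by decide)
  have h2 := h (show (2 : Fin 6) ≠ 1 by decide)
  have h3 := h (show (2 : Fin 6) ≠ 3 by decide)
  have h4 := h (show (2 : Fin 6) ≠ 4 by decide)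
  have h5 := h (show (2 : Fin 6) ≠ 5 by decide)
  have h6 : lamK 2 - lamK 1 + 1 ≠ 0 := lamK_sub_add_one_ne (by decide)
  have h7 : lamK 2 - lamK 1 - 1 ≠ 0 := lamK_sub_sub_one_ne (by decide)
  rw [toKK_mu (by decide), toKK_t_two]
  simp [extKK_shift_lamK, e, idx, sub_add_eq_sub_sub]
  field_simp

/-! ### A gauge in which the generators become shifts -/

/-- Units `pᵢ` with `pᵢ σᵢ(pⱼ) = μᵢⱼ pⱼ σⱼ(pᵢ)`. -/
noncomputable def gaugeX : Fin 3 → LLˣ :=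
  ![Units.map (sigma 0 : LL →* LL) (t 0),
    (Units.map (shift (e 1) : LL →* LL) (unitOf (r 1 2) (r_mem_S (by simp [Omega]))) *
      Units.map (shift (2 • e 1) : LL →* LL) (unitOf (r 1 2) (r_mem_S (by simp [Omega]))))⁻¹,
    1]

/-- The units `qᵢ = tᵢ / σᵢ⁻¹(pᵢ)`. -/
noncomputable def gaugeY (i : Fin 3) : LLˣ :=
  t i / Units.map ((sigma i).symm : LL →* LL) (gaugeX i)

theorem toKK_gaugeX_zero :
    toKK (gaugeX 0 : LL) = (lamK 0 - lamK 1) * (lamK 0 - lamK 2) := by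
  simp [gaugeX, sigma, toKK_apply, toKK_t_zero, extKK_shift_lamK, e, idx]
  ring

theorem toKK_gaugeX_one :
    toKK (gaugeX 1 : LL) = ((lamK 1 - lamK 2) * (lamK 1 - lamK 2 - 1))⁻¹ := by
  simp [-mul_inv_rev, gaugeX, map_ofNat toKK, coe_unitOf, algebraMap_r, toKK_lam, zeta, shift_lam, e]
  left
  ring

theorem toKK_gaugeX_two : toKK (gaugeX 2 : LL) = 1 := by simp [gaugeX]

theorem toKK_gaugeY (i : Fin 3) :
    toKK (gaugeY i : LL) =
      toKK (t i : LL) / extKK (shift (-e (idx i))) (toKK (gaugeX i : LL)) := by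
  rw [gaugeY, toKK_unit_div]
  simp [sigma, shift_symm, ← toKK_apply]

theorem toKK_gaugeY_zero : toKK (gaugeY 0 : LL) = 1 := by
  have h1 : lamK 0 - lamK 1 + 1 ≠ 0 := lamK_sub_add_one_ne (by decide)
  have h2 : lamK 0 - lamK 2 + 1 ≠ 0 := lamK_sub_add_one_ne (by decide)
  rw [toKK_gaugeY, toKK_t_zero, toKK_gaugeX_zero]
  simp [extKK_shift_lamK, e, idx]
  rw [add_sub_right_comm, add_sub_right_comm]
  exact div_self (mul_ne_zero h1 h2)

theorem toKK_gaugeY_one :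
    toKK (gaugeY 1 : LL) = (lamK 1 - lamK 0) * ((lamK 1 - lamK 3) * (lamK 1 - lamK 4) *
      (lamK 1 - lamK 5)) := by
  have h1 : lamK 1 - lamK 2 ≠ 0 := lamK_sub_ne (by decide)
  have h2 : lamK 1 - lamK 2 + 1 ≠ 0 := lamK_sub_add_one_ne (by decide)
  rw [toKK_gaugeY, toKK_t_one, toKK_gaugeX_one]
  simp [extKK_shift_lamK, e, idx, add_sub_right_comm]
  field_simp

theorem toKK_gaugeY_two :
    toKK (gaugeY 2 : LL) = (lamK 2 - lamK 0) * ((lamK 2 - lamK 3) * (lamK 2 - lamK 4) *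
      (lamK 2 - lamK 5)) / ((lamK 2 - lamK 1 + 1) * (lamK 2 - lamK 1)) := by
  rw [toKK_gaugeY, toKK_t_two, toKK_gaugeX_two]
  simp

theorem mu_self (i : Fin 3) : mu i i = 1 := if_pos rfl

/-- With p₂₂ = 1 the conditions against 22 read pᵢ = μᵢ,₂₂ σ₂₂(pᵢ). They are solved by p₁₁ =
σ₁₁(t₁₁) and by p₂₁ = 1/(z(z - 1)), z = λ₂₁ - λ₂₂, since σ₂₂ sends z to z + 1 and μ₂₁,₂₂ = (z +
1)/(z - 1). The condition for 11 and 21 then holds as well, p₂₁ being free of λ₁₁. -/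
theorem gaugeX_comm (i j : Fin 3) :
    (gaugeX i : LL) * sigma i (gaugeX j) = mu i j * (gaugeX j * sigma j (gaugeX i)) := by
  apply toKK_injective
  have h : ∀ {a b : Fin 6}, a ≠ b → lamK a - lamK b ≠ 0 := lamK_sub_ne
  have h0 := h (show (0 : Fin 6) ≠ 1 by decide)
  have h1 := h (show (0 : Fin 6) ≠ 2 by decide)
  have h2 := h (show (1 : Fin 6) ≠ 2 by decide)
  have h0' := h (show (1 : Fin 6) ≠ 0 by decide)
  have h1' := h (show (2 : Fin 6) ≠ 0 by decide)
  have h2' := h (show (2 : Fin 6) ≠ 1 by decide)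
  have h3 : lamK 0 - lamK 1 + 1 ≠ 0 := lamK_sub_add_one_ne (by decide)
  have h4 : lamK 0 - lamK 2 + 1 ≠ 0 := lamK_sub_add_one_ne (by decide)
  have h5 : lamK 1 - lamK 2 + 1 ≠ 0 := lamK_sub_add_one_ne (by decide)
  have h6 : lamK 1 - lamK 2 - 1 ≠ 0 := lamK_sub_sub_one_ne (by decide)
  have h6' : lamK 2 - lamK 1 - 1 ≠ 0 := lamK_sub_sub_one_ne (by decide)
  simp only [map_mul, sigma, toKK_apply]
  fin_cases i <;> fin_cases j
  · simp [mu_self]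
  · simp [toKK_gaugeX_zero, toKK_gaugeX_one, toKK_mu_zero_one, extKK_shift_lamK, e, idx]
    field_simp
    ring
  · simp [toKK_gaugeX_zero, toKK_gaugeX_two, toKK_mu_zero_two, extKK_shift_lamK, e, idx]
    field_simp
    ring
  · simp [toKK_gaugeX_zero, toKK_gaugeX_one, toKK_mu_one_zero, extKK_shift_lamK, e, idx]
    field_simp
    ring
  · simp [mu_self]
  · simp [-mul_inv_rev, toKK_gaugeX_one, toKK_gaugeX_two, toKK_mu_one_two, extKK_shift_lamK, e,
      idx, sub_sub_eq_add_sub, add_sub_right_comm]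
    field_simp
  · simp [toKK_gaugeX_zero, toKK_gaugeX_two, toKK_mu_two_zero, extKK_shift_lamK, e, idx]
    field_simp
    ring
  · simp [-mul_inv_rev, toKK_gaugeX_one, toKK_gaugeX_two, toKK_mu_two_one, extKK_shift_lamK, e,
      idx, sub_sub_eq_add_sub, add_sub_right_comm]
    field_simp
    ring
  · simp [mu_self]

/-- The qᵢ are already fixed by yᵢxᵢ = tᵢ, so this is a consistency check between the `x_x` and
`y_y` relations. It serves only the representation on 𝐋. -/
theorem gaugeY_comm (i j : Fin 3) :
    (gaugeY i : LL) * (sigma i).symm (gaugeY j) =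
      star (mu i j) * (gaugeY j * (sigma j).symm (gaugeY i)) := by
  apply toKK_injective
  have h : ∀ {a b : Fin 6}, a ≠ b → lamK a - lamK b ≠ 0 := lamK_sub_ne
  have h0 := h (show (0 : Fin 6) ≠ 1 by decide)
  have h1 := h (show (0 : Fin 6) ≠ 2 by decide)
  have h2 := h (show (1 : Fin 6) ≠ 2 by decide)
  have h0' := h (show (1 : Fin 6) ≠ 0 by decide)
  have h1' := h (show (2 : Fin 6) ≠ 0 by decide)
  have h2' := h (show (2 : Fin 6) ≠ 1 by decide)
  have h3 : lamK 1 - lamK 0 + 1 ≠ 0 := lamK_sub_add_one_ne (by decide)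
  have h4 : lamK 2 - lamK 0 + 1 ≠ 0 := lamK_sub_add_one_ne (by decide)
  have h5 : lamK 2 - lamK 1 + 1 ≠ 0 := lamK_sub_add_one_ne (by decide)
  have h6 : lamK 2 - lamK 1 - 1 ≠ 0 := lamK_sub_sub_one_ne (by decide)
  have h6' : lamK 1 - lamK 2 - 1 ≠ 0 := lamK_sub_sub_one_ne (by decide)
  -- These are the shapes that the denominators of μ take after the involution.
  have h7 : -lamK 0 - (1 - lamK 1) + 1 ≠ 0 := by convert h0' using 1; ring
  have h7' : -lamK 0 - (1 - lamK 2) + 1 ≠ 0 := by convert h1' using 1; ring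
  have h8 : 1 - lamK 1 + lamK 0 ≠ 0 := by
    convert lamK_sub_add_one_ne (show (0 : Fin 6) ≠ 1 by decide) using 1; ring
  have h8' : 1 - lamK 2 + lamK 0 ≠ 0 := by
    convert lamK_sub_add_one_ne (show (0 : Fin 6) ≠ 2 by decide) using 1; ring
  simp only [map_mul, sigma, toKK_apply, shift_symm]
  fin_cases i <;> fin_cases j
  · simp [mu_self]
  · simp [toKK_gaugeY_zero, toKK_gaugeY_one, toKK_mu_zero_one, extKK_shift_lamK,
      extKK_star_lamK, zeta, e, idx]
    field_simp
    ring
  · simp [toKK_gaugeY_zero, toKK_gaugeY_two, toKK_mu_zero_two, extKK_shift_lamK,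
      extKK_star_lamK, zeta, e, idx]
    field_simp
    ring
  · simp [toKK_gaugeY_zero, toKK_gaugeY_one, toKK_mu_one_zero, extKK_shift_lamK,
      extKK_star_lamK, zeta, e, idx]
    field_simp
    ring
  · simp [mu_self]
  · simp [-mul_inv_rev, toKK_gaugeY_one, toKK_gaugeY_two, toKK_mu_one_two, extKK_shift_lamK,
      extKK_star_lamK, zeta, e, idx, sub_add_eq_sub_sub]
    field_simp
  · simp [toKK_gaugeY_zero, toKK_gaugeY_two, toKK_mu_two_zero, extKK_shift_lamK,
      extKK_star_lamK, zeta, e, idx]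
    field_simp
    ring
  · simp [-mul_inv_rev, toKK_gaugeY_one, toKK_gaugeY_two, toKK_mu_two_one, extKK_shift_lamK,
      extKK_star_lamK, zeta, e, idx, sub_add_eq_sub_sub]
    field_simp
    ring
  · simp [mu_self]

theorem gaugeY_mul_gaugeX (i : Fin 3) : (gaugeY i : LL) * (sigma i).symm (gaugeX i) = t i := by
  have h : gaugeY i * Units.map ((sigma i).symm : LL →* LL) (gaugeX i) = t i :=
    div_mul_cancel _ _
  simpa using congrArg (Units.val) h

theorem gaugeX_mul_gaugeY (i : Fin 3) :
    (gaugeX i : LL) * sigma i (gaugeY i) = sigma i (t i : LL) := by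
  rw [← gaugeY_mul_gaugeX, map_mul, RingEquiv.apply_symm_apply, mul_comm]

end SU3

/-! ### The representation on the coefficient ring -/

namespace SU3

open MvPolynomial

/-- The shift as a `ℂ`-linear operator. -/
noncomputable def shiftLinear (n : Fin 6 → ℤ) : Module.End ℂ LL where
  toFun := shift n
  map_add' := map_add _
  map_smul' := shift_smul n

/-- The operators `f`, `xᵢ ↦ pᵢ σᵢ`, `yᵢ ↦ qᵢ σᵢ⁻¹`. -/
noncomputable def reprGen : RTGW.Gen LL (Fin 3) → Module.End ℂ LL
  | .coeff f => LinearMap.mulLeft ℂ f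
  | .x i => LinearMap.mulLeft ℂ (gaugeX i : LL) * shiftLinear (e (idx i))
  | .y i => LinearMap.mulLeft ℂ (gaugeY i : LL) * shiftLinear (-e (idx i))

theorem sigma_comm (i j : Fin 3) (f : LL) : sigma i (sigma j f) = sigma j (sigma i f) := by
  rw [sigma, sigma, shift_shift, shift_shift, add_comm]

theorem sigma_symm_comm (i j : Fin 3) (f : LL) :
    (sigma i).symm ((sigma j).symm f) = (sigma j).symm ((sigma i).symm f) := by
  rw [sigma, sigma, shift_symm, shift_symm, shift_symm, shift_symm, shift_shift, shift_shift,
    add_comm]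

/-- The operators σᵢ commute, so the `x_x` and `y_y` relations reduce to the two gauge identities;
`y_x` and `x_y` reduce to the definition of qᵢ. -/
theorem reprGen_rel ⦃a b : FreeAlgebra ℂ (RTGW.Gen LL (Fin 3))⦄
    (h : RTGW.Rel star sigma t mu a b) :
    FreeAlgebra.lift ℂ reprGen a = FreeAlgebra.lift ℂ reprGen b := by
  have hx (i : Fin 3) (f : LL) : reprGen (.x i) f = gaugeX i * sigma i f := rfl
  have hy (i : Fin 3) (f : LL) : reprGen (.y i) f = gaugeY i * (sigma i).symm f := by
    have h' : reprGen (.y i) f = gaugeY i * shift (-e (idx i)) f := rfl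
    rw [h', sigma, shift_symm]
  have hc (f g : LL) : reprGen (.coeff f) g = f * g := rfl
  cases h with
  | x_x i j =>
    ext g
    simp only [map_mul, FreeAlgebra.lift_ι_apply, Module.End.mul_apply, hx, hc,
      sigma_comm i j g]
    rw [← mul_assoc, gaugeX_comm, mul_assoc, mul_assoc]
  | y_y i j =>
    ext g
    simp only [map_mul, FreeAlgebra.lift_ι_apply, Module.End.mul_apply, hy, hc,
      sigma_symm_comm i j g]
    rw [← mul_assoc, gaugeY_comm, mul_assoc, mul_assoc]
  | y_x i =>
    ext g
    simp only [map_mul, FreeAlgebra.lift_ι_apply, Module.End.mul_apply, hx, hy, hc,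
      RingEquiv.symm_apply_apply, ← mul_assoc, gaugeY_mul_gaugeX]
  | x_y i =>
    ext g
    simp only [map_mul, FreeAlgebra.lift_ι_apply, Module.End.mul_apply, hx, hy, hc,
      RingEquiv.apply_symm_apply, ← mul_assoc, gaugeX_mul_gaugeY]
  | x_coeff i f =>
    ext g
    simp only [map_mul, FreeAlgebra.lift_ι_apply, Module.End.mul_apply, hx, hc]
    ring
  | y_coeff i f =>
    ext g
    simp only [map_mul, FreeAlgebra.lift_ι_apply, Module.End.mul_apply, hy, hc]
    ring
  | coeff_one => ext g; simp [hc]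
  | coeff_smul c f => ext g; simp [hc]
  | coeff_add f f' => ext g; simp [hc, add_mul]
  | coeff_mul f f' => ext g; simp [hc, mul_assoc]

/-- The representation of `𝔄` on its coefficient ring. -/
noncomputable def repr : A →ₐ[ℂ] Module.End ℂ LL :=
  RingQuot.liftAlgHom ℂ ⟨FreeAlgebra.lift ℂ reprGen, reprGen_rel⟩

theorem repr_rho (f g : LL) : repr (rho f) g = f * g := by
  have h : repr (rho f) = reprGen (.coeff f) := by
    change repr (RingQuot.mkAlgHom ℂ _ (FreeAlgebra.ι ℂ _)) = _
    rw [repr, RingQuot.liftAlgHom_mkAlgHom_apply, FreeAlgebra.lift_ι_apply]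
  rw [h]
  rfl

theorem rho_injective : Function.Injective rho := by
  intro f g h
  have := congrArg (fun a => repr a 1) h
  simpa [repr_rho] using this

/-! ### Commuting invertible shifts in the algebra -/

theorem rho_eq (f : LL) :
    rho f = RingQuot.mkAlgHom ℂ _ (FreeAlgebra.ι ℂ (RTGW.Gen.coeff f)) := rfl

theorem x_mul_rho (i : Fin 3) (f : LL) : x i * rho f = rho (sigma i f) * x i := by
  simpa [x, rho_eq, RTGW.gen] using RingQuot.mkAlgHom_rel ℂ (RTGW.Rel.x_coeff (inv := star)
    (σ := sigma) (t := t) (μ := mu) i f)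

theorem y_mul_rho (i : Fin 3) (f : LL) : y i * rho f = rho ((sigma i).symm f) * y i := by
  simpa [y, rho_eq, RTGW.gen] using RingQuot.mkAlgHom_rel ℂ (RTGW.Rel.y_coeff (inv := star)
    (σ := sigma) (t := t) (μ := mu) i f)

theorem y_mul_x (i : Fin 3) : y i * x i = rho (t i) := by
  simpa [x, y, rho_eq, RTGW.gen] using RingQuot.mkAlgHom_rel ℂ (RTGW.Rel.y_x (inv := star)
    (σ := sigma) (t := t) (μ := mu) i)

theorem x_mul_y (i : Fin 3) : x i * y i = rho (sigma i (t i)) := by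
  simpa [x, y, rho_eq, RTGW.gen] using RingQuot.mkAlgHom_rel ℂ (RTGW.Rel.x_y (inv := star)
    (σ := sigma) (t := t) (μ := mu) i)

theorem x_mul_x (i j : Fin 3) : x i * x j = rho (mu i j) * (x j * x i) := by
  simpa [x, rho_eq, RTGW.gen] using RingQuot.mkAlgHom_rel ℂ (RTGW.Rel.x_x (inv := star)
    (σ := sigma) (t := t) (μ := mu) i j)

/-- The invertible element `pᵢ⁻¹ xᵢ`, with inverse `qᵢ⁻¹ yᵢ`. -/
noncomputable def shiftUnit (i : Fin 3) : Aˣ where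
  val := rho ((gaugeX i)⁻¹ : LLˣ) * x i
  inv := rho ((gaugeY i)⁻¹ : LLˣ) * y i
  val_inv := by
    rw [mul_assoc, ← mul_assoc (x i), x_mul_rho, mul_assoc, x_mul_y, ← map_mul, ← map_mul,
      ← gaugeX_mul_gaugeY]
    have h : sigma i ((gaugeY i)⁻¹ : LLˣ) * sigma i (gaugeY i : LL) = 1 := by
      rw [← map_mul, Units.inv_mul, map_one]
    rw [← map_one rho]
    congr 1
    linear_combination (((gaugeX i)⁻¹ : LLˣ) * gaugeX i : LL) * h + (gaugeX i).inv_mul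
  inv_val := by
    rw [mul_assoc, ← mul_assoc (y i), y_mul_rho, mul_assoc, y_mul_x, ← map_mul, ← map_mul,
      ← gaugeY_mul_gaugeX]
    have h : (sigma i).symm ((gaugeX i)⁻¹ : LLˣ) * (sigma i).symm (gaugeX i : LL) = 1 := by
      rw [← map_mul, Units.inv_mul, map_one]
    rw [← map_one rho]
    congr 1
    linear_combination (((gaugeY i)⁻¹ : LLˣ) * gaugeY i : LL) * h + (gaugeY i).inv_mul

theorem x_eq (i : Fin 3) : x i = rho (gaugeX i) * shiftUnit i := by
  rw [shiftUnit, ← mul_assoc, ← map_mul, Units.mul_inv, map_one, one_mul]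

theorem y_eq (i : Fin 3) : y i = rho (gaugeY i) * (shiftUnit i)⁻¹ := by
  change y i = rho (gaugeY i) * (rho ((gaugeY i)⁻¹ : LLˣ) * y i)
  rw [← mul_assoc, ← map_mul, Units.mul_inv, map_one, one_mul]

theorem shiftUnit_mul_rho (i : Fin 3) (f : LL) :
    shiftUnit i * rho f = rho (sigma i f) * shiftUnit i := by
  rw [shiftUnit, mul_assoc, x_mul_rho, ← mul_assoc, ← mul_assoc, ← map_mul, ← map_mul, mul_comm]

theorem shiftUnit_inv_mul_rho (i : Fin 3) (f : LL) :
    ((shiftUnit i)⁻¹ : Aˣ) * rho f = rho ((sigma i).symm f) * ((shiftUnit i)⁻¹ : Aˣ) := by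
  rw [Units.inv_mul_eq_iff_eq_mul, ← mul_assoc, shiftUnit_mul_rho, RingEquiv.apply_symm_apply,
    mul_assoc, Units.mul_inv, mul_one]

/-- By `gaugeX_comm`, both sides of the `x_x` relation carry the same coefficient pᵢσᵢ(pⱼ), in front
of sᵢsⱼ and sⱼsᵢ respectively. That coefficient is a unit and cancels. -/
theorem shiftUnit_comm (i j : Fin 3) : Commute (shiftUnit i) (shiftUnit j) := by
  have h := x_mul_x i j
  rw [x_eq i, x_eq j] at h
  have hl : rho (gaugeX i) * (shiftUnit i : A) * (rho (gaugeX j) * shiftUnit j) =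
      rho (gaugeX i * sigma i (gaugeX j)) * (shiftUnit i * shiftUnit j) := by
    rw [map_mul, mul_assoc, ← mul_assoc (shiftUnit i : A), shiftUnit_mul_rho]
    simp only [mul_assoc]
  have hr : rho (mu i j) * (rho (gaugeX j) * (shiftUnit j : A) * (rho (gaugeX i) * shiftUnit i)) =
      rho (gaugeX i * sigma i (gaugeX j)) * (shiftUnit j * shiftUnit i) := by
    rw [gaugeX_comm, map_mul, map_mul, mul_assoc (rho (gaugeX j) : A),
      ← mul_assoc (shiftUnit j : A), shiftUnit_mul_rho]
    simp only [mul_assoc]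
  rw [hl, hr] at h
  let v : LLˣ := gaugeX i * Units.map (sigma i : LL →* LL) (gaugeX j)
  have hv : IsUnit (rho (gaugeX i * sigma i (gaugeX j))) := v.isUnit.map rho
  exact Units.ext (by simpa using hv.mul_left_cancel h)

/-- The monomial of exponent `(a, b, c)` in the commuting shifts. -/
noncomputable def mon (a b c : ℤ) : A :=
  ((shiftUnit 0 ^ a * shiftUnit 1 ^ b * shiftUnit 2 ^ c : Aˣ) : A)

theorem mon_mul_mon (a b c a' b' c' : ℤ) :
    mon a b c * mon a' b' c' = mon (a + a') (b + b') (c + c') := by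
  have h01 := (shiftUnit_comm 1 0).zpow_zpow b a'
  have h02 := (shiftUnit_comm 2 0).zpow_zpow c a'
  have h12 := (shiftUnit_comm 2 1).zpow_zpow c b'
  rw [mon, mon, mon, ← Units.val_mul, zpow_add, zpow_add, zpow_add]
  congr 1
  calc _ = shiftUnit 0 ^ a * (shiftUnit 1 ^ b * (shiftUnit 2 ^ c * shiftUnit 0 ^ a') *
        shiftUnit 1 ^ b' * shiftUnit 2 ^ c') := by group
    _ = shiftUnit 0 ^ a * ((shiftUnit 1 ^ b * shiftUnit 0 ^ a') * (shiftUnit 2 ^ c *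
        shiftUnit 1 ^ b') * shiftUnit 2 ^ c') := by rw [h02.eq]; group
    _ = _ := by rw [h01.eq, h12.eq]; group

theorem mon_zero : mon 0 0 0 = 1 := by simp [mon]

/-- The shift of the coefficient ring that belongs to the monomial of exponent `(a, b, c)`. -/
noncomputable def monShift (a b c : ℤ) : LL ≃+* LL := shift ![a, b, c, 0, 0, 0]

theorem shiftUnit_zpow_mul_rho (i : Fin 3) (n : ℤ) (f : LL) :
    ((shiftUnit i ^ n : Aˣ) : A) * rho f =
      rho (shift (n • e (idx i)) f) * ((shiftUnit i ^ n : Aˣ) : A) := by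
  induction n using Int.induction_on generalizing f with
  | zero => simp [shift_zero]
  | succ n ih =>
    rw [zpow_add_one, Units.val_mul, mul_assoc, shiftUnit_mul_rho, ← mul_assoc, ih, mul_assoc,
      sigma, shift_shift, add_smul, one_smul]
  | pred n ih =>
    rw [zpow_sub_one, Units.val_mul, mul_assoc, shiftUnit_inv_mul_rho, ← mul_assoc, ih, mul_assoc,
      sigma, shift_symm, shift_shift, sub_smul, one_smul, sub_eq_add_neg]

theorem mon_mul_rho (a b c : ℤ) (f : LL) :
    mon a b c * rho f = rho (monShift a b c f) * mon a b c := by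
  have h : monShift a b c f =
      shift (a • e (idx 0)) (shift (b • e (idx 1)) (shift (c • e (idx 2)) f)) := by
    have hn : ![a, b, c, 0, 0, 0] = a • e (idx 0) + b • e (idx 1) + c • e (idx 2) := by
      funext k
      fin_cases k <;> simp [e, idx]
    rw [shift_shift, shift_shift, monShift, hn]
  have key {u v : A} {φ : LL → LL} (hv : ∀ g, v * rho g = rho (φ g) * v) (g : LL) :
      u * v * rho g = u * rho (φ g) * v := by
    rw [mul_assoc, hv, mul_assoc]
  rw [h, mon, Units.val_mul, Units.val_mul, key (shiftUnit_zpow_mul_rho 2 c),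
    key (shiftUnit_zpow_mul_rho 1 b), shiftUnit_zpow_mul_rho, mul_assoc, mul_assoc, mul_assoc]

end SU3

/-! ### Computations in rings of shift operators -/

/-- Shift operators `mon a b c` with coefficients in a domain `L`, together with coefficients
`p₀, …, q₂` of the raising and lowering operators. -/
structure ShiftRing (L K B : Type) [CommRing L] [Field K] [Ring B] [Module L B] where
  toK : L →+* K
  toK_injective : Function.Injective toK
  mon : ℤ → ℤ → ℤ → B
  shL : ℤ → ℤ → ℤ → L ≃+* L
  shK : ℤ → ℤ → ℤ → K ≃+* K
  toK_shL : ∀ a b c f, toK (shL a b c f) = shK a b c (toK f)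
  shL_zero : ∀ f, shL 0 0 0 f = f
  mon_zero : mon 0 0 0 = 1
  smul_mul_smul : ∀ f g a b c a' b' c', (f • mon a b c) * (g • mon a' b' c') =
    (f * shL a b c g) • mon (a + a') (b + b') (c + c')
  lam : Fin 6 → L
  shK_lam : ∀ a b c i, shK a b c (toK (lam i)) =
    toK (lam i) - ((![a, b, c, 0, 0, 0] i : ℤ) : K)
  sub_add_ne_zero : ∀ n : ℤ, toK (lam 1) - toK (lam 2) + n ≠ 0
  p₀ : L
  p₁ : L
  p₂ : L
  q₀ : L
  q₁ : L
  q₂ : L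
  toK_p₀ : toK p₀ = (toK (lam 0) - toK (lam 1)) * (toK (lam 0) - toK (lam 2))
  toK_p₁ : toK p₁ = ((toK (lam 1) - toK (lam 2)) * (toK (lam 1) - toK (lam 2) - 1))⁻¹
  toK_p₂ : toK p₂ = 1
  toK_q₀ : toK q₀ = 1
  toK_q₁ : toK q₁ = (toK (lam 1) - toK (lam 0)) * ((toK (lam 1) - toK (lam 3)) *
    (toK (lam 1) - toK (lam 4)) * (toK (lam 1) - toK (lam 5)))
  toK_q₂ : toK q₂ = (toK (lam 2) - toK (lam 0)) * ((toK (lam 2) - toK (lam 3)) *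
    (toK (lam 2) - toK (lam 4)) * (toK (lam 2) - toK (lam 5))) /
      ((toK (lam 2) - toK (lam 1) + 1) * (toK (lam 2) - toK (lam 1)))

namespace ShiftRing

variable {L K B : Type} [CommRing L] [Field K] [Ring B] [Module L B] (R : ShiftRing L K B)

/-- The image `λᵢ` of a variable in the field. -/
def l (i : Fin 6) : K := R.toK (R.lam i)

/-- `λ₁ - λ₂ + n` in the field. -/
def z (n : ℤ) : K := R.l 1 - R.l 2 + n

theorem toK_lam (i : Fin 6) : R.toK (R.lam i) = R.l i := rfl

theorem z_ne_zero (n : ℤ) : R.z n ≠ 0 := R.sub_add_ne_zero n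

theorem shK_l (a b c : ℤ) (i : Fin 6) :
    R.shK a b c (R.l i) = R.l i - ((![a, b, c, 0, 0, 0] i : ℤ) : K) := R.shK_lam a b c i

/-- All denominators are products of the nonzero elements `z n`, which shifts merely permute.
Keeping `z` folded until the denominators are cleared makes the coefficient identities below
accessible to `field_simp`. -/
theorem shK_z (a b c n : ℤ) : R.shK a b c (R.z n) = R.z (n - b + c) := by
  simp [z, shK_l]
  ring

theorem toK_p₁_z : R.toK R.p₁ = (R.z 0 * R.z (-1))⁻¹ := by
  simp [R.toK_p₁, z, l, sub_eq_add_neg]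

theorem toK_q₂_z : R.toK R.q₂ = (R.l 2 - R.l 0) * ((R.l 2 - R.l 3) * (R.l 2 - R.l 4) *
    (R.l 2 - R.l 5)) / (R.z (-1) * R.z 0) := by
  rw [R.toK_q₂]
  congr 1
  simp [z, l]
  ring

/-- Embedding of the coefficients. -/
def co (f : L) : B := f • R.mon 0 0 0

/-- The raising operator `x₁₁`. -/
def X1 : B := R.p₀ • R.mon 1 0 0

/-- The lowering operator `y₁₁`. -/
def Y1 : B := R.q₀ • R.mon (-1) 0 0

/-- The raising operator `x₂₁ + x₂₂`. -/
def X2 : B := R.p₁ • R.mon 0 1 0 + R.p₂ • R.mon 0 0 1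

/-- The lowering operator `y₂₁ + y₂₂`. -/
def Y2 : B := R.q₁ • R.mon 0 (-1) 0 + R.q₂ • R.mon 0 0 (-1)

/-! ### Products of raising and lowering operators -/

theorem X1_mul_Y1 :
    R.X1 * R.Y1 = R.co ((R.lam 0 - R.lam 1) * (R.lam 0 - R.lam 2)) := by
  simp only [X1, Y1, co, R.smul_mul_smul]
  norm_num
  -- Equal coefficients suffice, so independence of the monomials is never needed; equality is
  -- tested in the field.
  match_scalars
  apply R.toK_injective
  simp [R.toK_shL, R.toK_p₀, R.toK_q₀]

theorem Y1_mul_X1 :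
    R.Y1 * R.X1 = R.co ((R.lam 0 - R.lam 1 + 1) * (R.lam 0 - R.lam 2 + 1)) := by
  simp only [X1, Y1, co, R.smul_mul_smul]
  norm_num
  match_scalars
  apply R.toK_injective
  simp [R.toK_shL, R.toK_p₀, R.toK_q₀, toK_lam, shK_l]
  ring

/-- The mixed terms with exponents (0, 1, -1) and (0, -1, 1) cancel, and in the four diagonal terms
the poles along integer translates of λ₂₁ = λ₂₂ cancel. -/
theorem X2_mul_Y2_sub : R.X2 * R.Y2 - R.Y2 * R.X2 =
    -R.co (2 * (R.lam 1 + R.lam 2 - 1) - R.lam 0 - (R.lam 3 + R.lam 4 + R.lam 5)) := by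
  simp only [X2, Y2, co, add_mul, mul_add, R.smul_mul_smul]
  norm_num
  match_scalars <;> apply R.toK_injective <;>
    simp [R.toK_shL, toK_p₁_z, R.toK_p₂, R.toK_q₁, toK_q₂_z, toK_lam, shK_l, shK_z,
      map_ofNat R.toK] <;>
    field_simp [R.z_ne_zero] <;> simp only [z] <;> push_cast <;> ring

theorem X1_mul_Y2 : R.X1 * R.Y2 = R.Y2 * R.X1 := by
  simp only [X1, Y2, add_mul, mul_add, R.smul_mul_smul]
  norm_num
  match_scalars <;> apply R.toK_injective <;>
    simp [R.toK_shL, R.toK_p₀, R.toK_q₁, toK_q₂_z, toK_lam, shK_l, shK_z] <;> ring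

theorem X2_mul_Y1 : R.X2 * R.Y1 = R.Y1 * R.X2 := by
  simp only [X2, Y1, add_mul, mul_add, R.smul_mul_smul]
  norm_num
  match_scalars <;> apply R.toK_injective <;>
    simp [R.toK_shL, toK_p₁_z, R.toK_p₂, R.toK_q₀, shK_z]

/-- The raising operator `[X2, X1]`. -/
def X3 : B := R.X2 * R.X1 - R.X1 * R.X2

/-- The lowering operator `[Y1, Y2]`. -/
def Y3 : B := R.Y1 * R.Y2 - R.Y2 * R.Y1

/-- The first coefficient of `X3`. -/
def a₁ : L := R.p₁ * (R.lam 0 - R.lam 2)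

/-- The second coefficient of `X3`. -/
def a₂ : L := R.lam 0 - R.lam 1

theorem X3_eq : R.X3 = R.a₁ • R.mon 1 1 0 + R.a₂ • R.mon 1 0 1 := by
  simp only [X3, X2, X1, add_mul, mul_add, R.smul_mul_smul]
  norm_num
  match_scalars <;> apply R.toK_injective <;>
    simp [R.toK_shL, toK_p₁_z, R.toK_p₀, R.toK_p₂, toK_lam, shK_l, shK_z, a₁, a₂] <;> ring

/-- The first coefficient of `Y3`. -/
def b₁ : L := -((R.lam 1 - R.lam 3) * (R.lam 1 - R.lam 4) * (R.lam 1 - R.lam 5))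

/-- The second coefficient of `Y3`. -/
def b₂ : L := R.p₁ * -((R.lam 2 - R.lam 3) * (R.lam 2 - R.lam 4) *
  (R.lam 2 - R.lam 5))

theorem Y3_eq : R.Y3 = R.b₁ • R.mon (-1) (-1) 0 + R.b₂ • R.mon (-1) 0 (-1) := by
  simp only [Y3, Y2, Y1, add_mul, mul_add, R.smul_mul_smul]
  norm_num
  match_scalars <;> apply R.toK_injective <;>
    simp [R.toK_shL, R.toK_q₁, R.toK_q₀, toK_q₂_z, toK_p₁_z, toK_lam, shK_l, shK_z, b₁, b₂] <;> ring

theorem X1_mul_X3 : R.X1 * R.X3 = R.X3 * R.X1 := by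
  simp only [X3_eq, X1, add_mul, mul_add, R.smul_mul_smul]
  norm_num
  match_scalars <;> apply R.toK_injective <;>
    simp [R.toK_shL, toK_p₁_z, R.toK_p₀, toK_lam, shK_l, shK_z, a₁, a₂] <;> ring

theorem Y1_mul_Y3 : R.Y1 * R.Y3 = R.Y3 * R.Y1 := by
  simp only [Y3_eq, Y1, add_mul, mul_add, R.smul_mul_smul]
  norm_num
  match_scalars <;> apply R.toK_injective <;>
    simp [R.toK_shL, toK_p₁_z, R.toK_q₀, toK_lam, shK_l, shK_z, b₁, b₂]

theorem X2_mul_X3 : R.X2 * R.X3 = R.X3 * R.X2 := by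
  simp only [X3_eq, X2, add_mul, mul_add, R.smul_mul_smul]
  norm_num
  match_scalars <;> apply R.toK_injective <;>
    simp [R.toK_shL, toK_p₁_z, R.toK_p₂, toK_lam, shK_l, shK_z, a₁, a₂] <;>
    field_simp [R.z_ne_zero] <;> simp only [z] <;> push_cast <;> ring

theorem Y2_mul_Y3 : R.Y2 * R.Y3 = R.Y3 * R.Y2 := by
  simp only [Y3_eq, Y2, add_mul, mul_add, R.smul_mul_smul]
  norm_num
  match_scalars <;> apply R.toK_injective <;>
    simp [R.toK_shL, toK_p₁_z, R.toK_q₁, toK_q₂_z, toK_lam, shK_l, shK_z, b₁, b₂] <;>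
    field_simp [R.z_ne_zero] <;> simp only [z] <;> push_cast <;> ring

/-- The mixed terms cancel, and λ₁₁ drops out of the diagonal ones. What is left is the divided
difference at λ₂₁, λ₂₂ of g(u) = ∏(u - λ₃ₖ), up to sign. -/
theorem W_eq : R.Y3 * R.X3 - R.Y2 * R.X2 = -R.co (R.lam 1 ^ 2 + R.lam 1 * R.lam 2 + R.lam 2 ^ 2
    - (R.lam 3 + R.lam 4 + R.lam 5) * (R.lam 1 + R.lam 2)
    + (R.lam 3 * R.lam 4 + R.lam 4 * R.lam 5 + R.lam 3 * R.lam 5)) := by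
  simp only [Y3_eq, X3_eq, X2, Y2, co, add_mul, mul_add, R.smul_mul_smul]
  norm_num
  match_scalars <;> apply R.toK_injective <;>
    simp [R.toK_shL, toK_p₁_z, R.toK_p₂, R.toK_q₁, toK_q₂_z, toK_lam, shK_l, shK_z,
      a₁, a₂, b₁, b₂] <;>
    field_simp [R.z_ne_zero] <;> (try simp only [z]) <;> push_cast <;> ring

/-- Together with `colA2`: the upper 2 × 2 block of `glE`, applied to the column (E₁₃, E₂₃), has the
s₂₁ part and the s₂₂ part of the column as eigenvectors, with left eigenvalues λ₂₁ and λ₂₂. -/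
theorem colA1 : R.co (R.lam 0) * R.X3 - R.X1 * R.X2 =
    (R.lam 1 * R.a₁) • R.mon 1 1 0 + (R.lam 2 * R.a₂) • R.mon 1 0 1 := by
  simp only [X3_eq, X2, X1, co, mul_add, R.smul_mul_smul]
  norm_num
  match_scalars <;> apply R.toK_injective <;>
    simp [R.toK_shL, toK_p₁_z, R.toK_p₀, R.toK_p₂, toK_lam, shK_l, shK_z, a₁, a₂] <;> ring

theorem colA2 : R.Y1 * R.X3 + R.co (R.lam 1 + R.lam 2 - 1 - R.lam 0) * R.X2 =
    (R.lam 1 * R.p₁) • R.mon 0 1 0 + (R.lam 2 * R.p₂) • R.mon 0 0 1 := by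
  simp only [X3_eq, X2, Y1, co, mul_add, R.smul_mul_smul]
  norm_num
  match_scalars <;> apply R.toK_injective <;>
    simp [R.toK_shL, toK_p₁_z, R.toK_q₀, R.toK_p₂, toK_lam, shK_l, shK_z, a₁, a₂] <;> ring

/-- By the eigenvalue form of the column this is W with weights λ₂₁, λ₂₂ inserted. Moving a weight
to the left of a lowering operator adds 1 to it, so g(u) is replaced by (u + 1)g(u) in the divided
difference. -/
theorem V_eq : R.Y3 * (R.co (R.lam 0) * R.X3 - R.X1 * R.X2) -
      R.Y2 * (R.Y1 * R.X3 + R.co (R.lam 1 + R.lam 2 - 1 - R.lam 0) * R.X2) =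
    -R.co ((R.lam 1 + R.lam 2) * (R.lam 1 ^ 2 + R.lam 2 ^ 2)
      - (R.lam 3 + R.lam 4 + R.lam 5) * (R.lam 1 ^ 2 + R.lam 1 * R.lam 2 + R.lam 2 ^ 2)
      + (R.lam 3 * R.lam 4 + R.lam 4 * R.lam 5 + R.lam 3 * R.lam 5) * (R.lam 1 + R.lam 2)
      - R.lam 3 * R.lam 4 * R.lam 5
      + (R.lam 1 ^ 2 + R.lam 1 * R.lam 2 + R.lam 2 ^ 2
        - (R.lam 3 + R.lam 4 + R.lam 5) * (R.lam 1 + R.lam 2)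
        + (R.lam 3 * R.lam 4 + R.lam 4 * R.lam 5 + R.lam 3 * R.lam 5))) := by
  rw [colA1, colA2]
  simp only [Y3_eq, Y2, co, add_mul, mul_add, R.smul_mul_smul]
  norm_num
  match_scalars <;> apply R.toK_injective <;>
    simp [R.toK_shL, toK_p₁_z, R.toK_p₂, R.toK_q₁, toK_q₂_z, toK_lam, shK_l, shK_z,
      a₁, a₂, b₁, b₂] <;>
    field_simp [R.z_ne_zero] <;> (try simp only [z]) <;> push_cast <;> ring

end ShiftRing

/-! ### The gl₃ relations -/

namespace ShiftRing

variable {L K B : Type} [CommRing L] [Field K] [Ring B] [Module L B] (R : ShiftRing L K B)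

theorem co_mul_co (f g : L) : R.co f * R.co g = R.co (f * g) := by
  rw [co, co, R.smul_mul_smul, R.shL_zero]
  rfl

theorem co_add (f g : L) : R.co (f + g) = R.co f + R.co g := add_smul _ _ _

theorem co_sub (f g : L) : R.co (f - g) = R.co f - R.co g := sub_smul _ _ _

theorem co_neg (f : L) : R.co (-f) = -R.co f := neg_smul _ _

theorem co_one : R.co 1 = 1 := by rw [co, one_smul, R.mon_zero]

theorem co_ofNat (n : ℕ) [n.AtLeastTwo] : (OfNat.ofNat n : B) = R.co (OfNat.ofNat n) := by
  have h (m : ℕ) : R.co m = m := by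
    induction m with
    | zero => simp [co]
    | succ m ih => rw [Nat.cast_succ, co_add, ih, co_one, Nat.cast_succ]
  simpa using (h (OfNat.ofNat n)).symm

theorem lie_co_co (f g : L) : ⁅R.co f, R.co g⁆ = 0 := by
  rw [Ring.lie_def, co_mul_co, co_mul_co, mul_comm, sub_self]

/-- The image of the first diagonal matrix unit. -/
def D1 : B := R.co (R.lam 0)

/-- The image of the second diagonal matrix unit. -/
def D2 : B := R.co (R.lam 1 + R.lam 2 - 1 - R.lam 0)

/-- The image of the third diagonal matrix unit. -/
def D3 : B := R.co (R.lam 3 + R.lam 4 + R.lam 5 - (R.lam 1 + R.lam 2 - 1))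

theorem shL_lam (a b c : ℤ) (i : Fin 6) :
    R.shL a b c (R.lam i) = R.lam i - ((![a, b, c, 0, 0, 0] i : ℤ) : L) := by
  apply R.toK_injective
  rw [R.toK_shL, R.shK_lam, map_sub, map_intCast]

/-- A linear coefficient changes under a shift by a constant, so every shift operator is a weight
vector for the diagonal elements. -/
theorem lie_co_smul_mon (g f : L) (a b c : ℤ) :
    ⁅R.co g, f • R.mon a b c⁆ = ((g - R.shL a b c g) * f) • R.mon a b c := by
  rw [Ring.lie_def, co, R.smul_mul_smul, R.smul_mul_smul, R.shL_zero]
  simp only [zero_add, add_zero, ← sub_smul]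
  congr 1
  ring

theorem lie_D1_X1 : ⁅R.D1, R.X1⁆ = R.X1 := by
  simp [D1, X1, lie_co_smul_mon, shL_lam]

theorem lie_D1_Y1 : ⁅R.D1, R.Y1⁆ = -R.Y1 := by
  simp [D1, Y1, lie_co_smul_mon, shL_lam]

theorem lie_D1_X2 : ⁅R.D1, R.X2⁆ = 0 := by
  simp [D1, X2, lie_co_smul_mon, shL_lam]

theorem lie_D1_Y2 : ⁅R.D1, R.Y2⁆ = 0 := by
  simp [D1, Y2, lie_co_smul_mon, shL_lam]

theorem lie_D2_X1 : ⁅R.D2, R.X1⁆ = -R.X1 := by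
  simp [D2, X1, lie_co_smul_mon, shL_lam]

theorem lie_D2_Y1 : ⁅R.D2, R.Y1⁆ = R.Y1 := by
  simp [D2, Y1, lie_co_smul_mon, shL_lam]

theorem lie_D2_X2 : ⁅R.D2, R.X2⁆ = R.X2 := by
  simp only [D2, X2, lie_add, lie_co_smul_mon, map_add, map_sub, map_one, shL_lam]
  simp

theorem lie_D2_Y2 : ⁅R.D2, R.Y2⁆ = -R.Y2 := by
  simp only [D2, Y2, lie_add, lie_co_smul_mon, map_add, map_sub, map_one, shL_lam]
  simp
  module

theorem lie_D3_X1 : ⁅R.D3, R.X1⁆ = 0 := by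
  simp [D3, X1, lie_co_smul_mon, shL_lam]

theorem lie_D3_Y1 : ⁅R.D3, R.Y1⁆ = 0 := by
  simp [D3, Y1, lie_co_smul_mon, shL_lam]

theorem lie_D3_X2 : ⁅R.D3, R.X2⁆ = -R.X2 := by
  simp only [D3, X2, lie_add, lie_co_smul_mon, map_add, map_sub, map_one, shL_lam]
  simp
  module

theorem lie_D3_Y2 : ⁅R.D3, R.Y2⁆ = R.Y2 := by
  simp only [D3, Y2, lie_add, lie_co_smul_mon, map_add, map_sub, map_one, shL_lam]
  simp

theorem lie_X1_Y1 : ⁅R.X1, R.Y1⁆ = R.D2 - R.D1 := by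
  rw [Ring.lie_def, X1_mul_Y1, Y1_mul_X1, D1, D2, ← co_sub, ← co_sub]
  congr 1
  ring

theorem lie_X2_Y2 : ⁅R.X2, R.Y2⁆ = R.D3 - R.D2 := by
  rw [Ring.lie_def, X2_mul_Y2_sub, D2, D3, ← co_sub, ← co_neg]
  congr 1
  ring

theorem lie_X1_Y2 : ⁅R.X1, R.Y2⁆ = 0 := by rw [Ring.lie_def, X1_mul_Y2, sub_self]

theorem lie_X2_Y1 : ⁅R.X2, R.Y1⁆ = 0 := by rw [Ring.lie_def, X2_mul_Y1, sub_self]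

theorem lie_X1_X3 : ⁅R.X1, R.X3⁆ = 0 := by rw [Ring.lie_def, X1_mul_X3, sub_self]

theorem lie_X2_X3 : ⁅R.X2, R.X3⁆ = 0 := by rw [Ring.lie_def, X2_mul_X3, sub_self]

theorem lie_Y1_Y3 : ⁅R.Y1, R.Y3⁆ = 0 := by rw [Ring.lie_def, Y1_mul_Y3, sub_self]

theorem lie_Y2_Y3 : ⁅R.Y2, R.Y3⁆ = 0 := by rw [Ring.lie_def, Y2_mul_Y3, sub_self]

theorem lie_X2_X1 : ⁅R.X2, R.X1⁆ = R.X3 := rfl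

theorem lie_Y1_Y2 : ⁅R.Y1, R.Y2⁆ = R.Y3 := rfl

/-- From here on the brackets follow from the Jacobi identity, without further comparison of
coefficients. -/
theorem lie_D1_X3 : ⁅R.D1, R.X3⁆ = R.X3 := by
  rw [← lie_X2_X1, leibniz_lie, lie_D1_X1, lie_D1_X2, zero_lie, zero_add]

theorem lie_D2_X3 : ⁅R.D2, R.X3⁆ = 0 := by
  rw [← lie_X2_X1, leibniz_lie, lie_D2_X1, lie_D2_X2, lie_neg, add_neg_cancel]

theorem lie_D3_X3 : ⁅R.D3, R.X3⁆ = -R.X3 := by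
  rw [← lie_X2_X1, leibniz_lie, lie_D3_X1, lie_D3_X2, lie_zero, add_zero, neg_lie]

theorem lie_D1_Y3 : ⁅R.D1, R.Y3⁆ = -R.Y3 := by
  rw [← lie_Y1_Y2, leibniz_lie, lie_D1_Y1, lie_D1_Y2, lie_zero, add_zero, neg_lie]

theorem lie_D2_Y3 : ⁅R.D2, R.Y3⁆ = 0 := by
  rw [← lie_Y1_Y2, leibniz_lie, lie_D2_Y1, lie_D2_Y2, lie_neg, add_neg_cancel]

theorem lie_D3_Y3 : ⁅R.D3, R.Y3⁆ = R.Y3 := by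
  rw [← lie_Y1_Y2, leibniz_lie, lie_D3_Y1, lie_D3_Y2, zero_lie, zero_add]

theorem lie_X3_Y1 : ⁅R.X3, R.Y1⁆ = -R.X2 := by
  rw [← lie_X2_X1, lie_lie, lie_X1_Y1, lie_X2_Y1, lie_zero, sub_zero, lie_sub, ← lie_skew,
    lie_D2_X2, ← lie_skew R.X2, lie_D1_X2, neg_zero, sub_zero]

theorem lie_X3_Y2 : ⁅R.X3, R.Y2⁆ = R.X1 := by
  rw [← lie_X2_X1, lie_lie, lie_X1_Y2, lie_X2_Y2, lie_zero, zero_sub, lie_sub, ← lie_skew,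
    lie_D3_X1, ← lie_skew R.X1, lie_D2_X1, neg_zero, zero_sub, neg_neg, neg_neg]

theorem lie_X1_Y3 : ⁅R.X1, R.Y3⁆ = -R.Y2 := by
  rw [← lie_Y1_Y2, leibniz_lie, lie_X1_Y1, lie_X1_Y2, lie_zero, add_zero, sub_lie, lie_D2_Y2,
    lie_D1_Y2, sub_zero]

theorem lie_X2_Y3 : ⁅R.X2, R.Y3⁆ = R.Y1 := by
  rw [← lie_Y1_Y2, leibniz_lie, lie_X2_Y1, lie_X2_Y2, zero_lie, zero_add, lie_sub, ← lie_skew,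
    lie_D3_Y1, ← lie_skew R.Y1, lie_D2_Y1, neg_zero, zero_sub, neg_neg]

theorem lie_X3_Y3 : ⁅R.X3, R.Y3⁆ = R.D1 - R.D3 := by
  rw [← lie_Y1_Y2, leibniz_lie, lie_X3_Y1, lie_X3_Y2, neg_lie, lie_X2_Y2, ← lie_skew, lie_X1_Y1]
  abel

variable [Algebra ℂ B]

/-- The images of the matrix units. -/
noncomputable def glE : Matrix (Fin 3) (Fin 3) B :=
  !![R.D1, -Complex.I • R.X1, R.X3; -Complex.I • R.Y1, R.D2, -Complex.I • R.X2;
    R.Y3, -Complex.I • R.Y2, R.D3]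

/-- The factors -i on the simple root vectors of `glE` correct the sign in [X₁, Y₁] = D₂ - D₁ and
[X₂, Y₂] = D₃ - D₂; since (-i)² = -1, the entries X₃ and Y₃ need no factor. Ordering the index pairs
halves the cases, the others following by antisymmetry. -/
theorem lie_glE_of_le (i j k l : Fin 3) (h : 3 * (i : ℕ) + j ≤ 3 * k + l) :
    ⁅R.glE i j, R.glE k l⁆ =
      (if j = k then R.glE i l else 0) - (if l = i then R.glE k j else 0) := by
  have hX1D2 : ⁅R.X1, R.D2⁆ = R.X1 := by rw [← lie_skew, lie_D2_X1, neg_neg]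
  have hX1D3 : ⁅R.X1, R.D3⁆ = 0 := by rw [← lie_skew, lie_D3_X1, neg_zero]
  have hX3D2 : ⁅R.X3, R.D2⁆ = 0 := by rw [← lie_skew, lie_D2_X3, neg_zero]
  have hX3D3 : ⁅R.X3, R.D3⁆ = R.X3 := by rw [← lie_skew, lie_D3_X3, neg_neg]
  have hY1D2 : ⁅R.Y1, R.D2⁆ = -R.Y1 := by rw [← lie_skew, lie_D2_Y1]
  have hY1D3 : ⁅R.Y1, R.D3⁆ = 0 := by rw [← lie_skew, lie_D3_Y1, neg_zero]
  have hX2D3 : ⁅R.X2, R.D3⁆ = R.X2 := by rw [← lie_skew, lie_D3_X2, neg_neg]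
  have hY3D3 : ⁅R.Y3, R.D3⁆ = -R.Y3 := by rw [← lie_skew, lie_D3_Y3]
  have hY2D3 : ⁅R.Y2, R.D3⁆ = -R.Y2 := by rw [← lie_skew, lie_D3_Y2]
  have hX1X2 : ⁅R.X1, R.X2⁆ = -R.X3 := by rw [← lie_skew, lie_X2_X1]
  have hX3X2 : ⁅R.X3, R.X2⁆ = 0 := by rw [← lie_skew, lie_X2_X3, neg_zero]
  have hY1X2 : ⁅R.Y1, R.X2⁆ = 0 := by rw [← lie_skew, lie_X2_Y1, neg_zero]
  have hX3Y1 := R.lie_X3_Y1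
  have hY3Y2 : ⁅R.Y3, R.Y2⁆ = 0 := by rw [← lie_skew, lie_Y2_Y3, neg_zero]
  have hDD : ⁅R.D1, R.D2⁆ = 0 ∧ ⁅R.D1, R.D3⁆ = 0 ∧ ⁅R.D2, R.D3⁆ = 0 :=
    ⟨R.lie_co_co _ _, R.lie_co_co _ _, R.lie_co_co _ _⟩
  obtain ⟨hD12, hD13, hD23⟩ := hDD
  fin_cases i <;> fin_cases j <;> fin_cases k <;> fin_cases l <;>
    first
    | exact absurd h (by decide)
    | simp [glE, smul_smul, lie_D1_X1, lie_D1_Y1, lie_D1_X2, lie_D1_Y2, lie_D2_X2, lie_D2_Y2,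
        lie_X1_Y1, lie_X2_Y2, lie_X1_Y2, lie_X1_X3, lie_Y1_Y3, lie_Y1_Y2, lie_D1_X3, lie_D1_Y3,
        lie_D2_Y3, lie_X3_Y2, lie_X1_Y3, lie_X2_Y3, lie_X3_Y3, *]

theorem lie_glE (i j k l : Fin 3) : ⁅R.glE i j, R.glE k l⁆ =
    (if j = k then R.glE i l else 0) - (if l = i then R.glE k j else 0) := by
  rcases le_total (3 * (i : ℕ) + j) (3 * k + l) with h | h
  · exact R.lie_glE_of_le i j k l h
  · rw [← lie_skew, R.lie_glE_of_le k l i j h, neg_sub]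

end ShiftRing

/-! ### Traces of powers of a `gl₃` matrix -/

section Trace

variable {B : Type} [Ring B] {e : Matrix (Fin 3) (Fin 3) B}

/-- Normal ordering: each Eᵢ₃E₃ᵢ becomes E₃ᵢEᵢ₃ + Eᵢᵢ - E₃₃, so only the row-times-column sum W has
to be known. -/
theorem trace_sq_of_lie (h : ∀ i j k l, ⁅e i j, e k l⁆ =
    (if j = k then e i l else 0) - (if l = i then e k j else 0)) :
    ∑ i, ∑ j, e i j * e j i = e 0 0 * e 0 0 + e 1 1 * e 1 1 + e 2 2 * e 2 2 + e 0 1 * e 1 0 +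
      e 1 0 * e 0 1 + 2 * (e 2 0 * e 0 2 + e 2 1 * e 1 2) + (e 0 0 + e 1 1 - 2 * e 2 2) := by
  have h0 := h 0 2 2 0
  have h1 := h 1 2 2 1
  simp only [Ring.lie_def, if_true] at h0 h1
  simp only [Fin.sum_univ_three]
  linear_combination (norm := noncomm_ring) h0 + h1

/-- Normal ordering again: every E₃ᵢ moves to the left of the Eⱼ₃, leaving V three times, W with
factors E₃₃, and the cube of the 2 × 2 block written through E₁₂E₂₁ and E₂₁E₁₂. -/
theorem trace_cube_of_lie (h : ∀ i j k l, ⁅e i j, e k l⁆ =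
    (if j = k then e i l else 0) - (if l = i then e k j else 0)) :
    ∑ i, ∑ j, ∑ k, e i j * e j k * e k i =
      (e 0 0 * e 0 0 * e 0 0 + e 0 0 * (e 0 1 * e 1 0) + e 0 1 * e 1 0 * e 0 0 +
        e 1 0 * e 0 1 * (e 0 0 + 1) + e 1 1 * e 1 1 * e 1 1 + e 1 1 * (e 1 0 * e 0 1) +
        e 1 0 * e 0 1 * e 1 1 + e 0 1 * e 1 0 * (e 1 1 + 1)) +
      3 * (e 2 0 * (e 0 0 * e 0 2 + e 0 1 * e 1 2) + e 2 1 * (e 1 0 * e 0 2 + e 1 1 * e 1 2)) -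
      4 * (e 2 0 * e 0 2 + e 2 1 * e 1 2) +
      2 * (e 0 0 * e 0 0 + e 0 1 * e 1 0 + e 1 0 * e 0 1 + e 1 1 * e 1 1) -
      (e 0 0 + e 1 1) * e 2 2 - e 2 2 * (e 0 0 + e 1 1) +
      (e 2 0 * e 0 2 + e 2 1 * e 1 2 + e 0 0 + e 1 1 - 2 * e 2 2) * (e 2 2 + 1) +
      e 2 2 * (e 2 0 * e 0 2 + e 2 1 * e 1 2) + (e 2 0 * e 0 2 + e 2 1 * e 1 2) * e 2 2 +
      e 2 2 * e 2 2 * e 2 2 := by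
  have b00 := h 0 2 2 0
  have b01 := h 0 2 2 1
  have b10 := h 1 2 2 0
  have b11 := h 1 2 2 1
  have c00 := h 0 0 2 0
  have c01 := h 0 1 2 0
  have c10 := h 1 0 2 1
  have c11 := h 1 1 2 1
  have d00 := h 0 0 0 2
  have d01 := h 0 1 1 2
  have d10 := h 1 0 0 2
  have d11 := h 1 1 1 2
  have z0 := h 2 2 2 0
  have z1 := h 2 2 2 1
  have a0 := h 0 0 0 1
  have a1 := h 1 1 1 0
  simp [Ring.lie_def] at b00 b01 b10 b11 c00 c01 c10 c11 d00 d01 d10 d11 z0 z1 a0 a1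
  simp only [Fin.sum_univ_three]
  -- Each summand is one exchange of neighbouring factors, multiplied by the factor that stands
  -- beside it.
  linear_combination (norm := noncomm_ring)
    e 0 0 * b00 + e 0 1 * b10 + e 1 0 * b01 + e 1 1 * b11
    + c00 * e 0 2 + c01 * e 1 2 + c10 * e 0 2 + c11 * e 1 2
    + b00 * e 0 0 + b01 * e 1 0 + b10 * e 0 1 + b11 * e 1 1
    - e 2 0 * d00 - e 2 0 * d01 - e 2 1 * d10 - e 2 1 * d11
    + e 0 2 * z0 + e 1 2 * z1 + b00 * (e 2 2 + 1) + b11 * (e 2 2 + 1)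
    + e 1 0 * a0 + e 0 1 * a1

end Trace

/-! ### Values of the traces of powers of `glE` -/

namespace ShiftRing

variable {L K B : Type} [CommRing L] [Field K] [Ring B] [Module L B] [Algebra ℂ B]
  (R : ShiftRing L K B)

theorem trace_glE : ∑ i, R.glE i i = R.co (R.lam 3 + R.lam 4 + R.lam 5) := by
  simp only [Fin.sum_univ_three, glE, Matrix.of_apply, Matrix.cons_val, D1, D2, D3, ← co_add]
  congr 1
  ring

/-- The entries of `glE` that are used in the traces. -/
theorem glE_diag : R.glE 0 0 = R.D1 ∧ R.glE 1 1 = R.D2 ∧ R.glE 2 2 = R.D3 := ⟨rfl, rfl, rfl⟩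

theorem glE_zero_one_mul : R.glE 0 1 * R.glE 1 0 =
    -R.co ((R.lam 0 - R.lam 1) * (R.lam 0 - R.lam 2)) := by
  simp [glE, smul_smul, X1_mul_Y1]

theorem glE_one_zero_mul : R.glE 1 0 * R.glE 0 1 =
    -R.co ((R.lam 0 - R.lam 1 + 1) * (R.lam 0 - R.lam 2 + 1)) := by
  simp [glE, smul_smul, Y1_mul_X1]

/-- The coefficient of `∑ Eₛᵢ Eᵢₛ` with `s = 3`. -/
def w : L := -(R.lam 1 ^ 2 + R.lam 1 * R.lam 2 + R.lam 2 ^ 2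
    - (R.lam 3 + R.lam 4 + R.lam 5) * (R.lam 1 + R.lam 2)
    + (R.lam 3 * R.lam 4 + R.lam 4 * R.lam 5 + R.lam 3 * R.lam 5))

theorem glE_row_mul_col : R.glE 2 0 * R.glE 0 2 + R.glE 2 1 * R.glE 1 2 = R.co R.w := by
  rw [w, co_neg, ← W_eq]
  simp [glE, smul_smul]
  abel

/-- The coefficient of `∑ Eₛᵢ Eᵢⱼ Eⱼₛ` with `s = 3`. -/
def v : L := -((R.lam 1 + R.lam 2) * (R.lam 1 ^ 2 + R.lam 2 ^ 2)
      - (R.lam 3 + R.lam 4 + R.lam 5) * (R.lam 1 ^ 2 + R.lam 1 * R.lam 2 + R.lam 2 ^ 2)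
      + (R.lam 3 * R.lam 4 + R.lam 4 * R.lam 5 + R.lam 3 * R.lam 5) * (R.lam 1 + R.lam 2)
      - R.lam 3 * R.lam 4 * R.lam 5
      + (R.lam 1 ^ 2 + R.lam 1 * R.lam 2 + R.lam 2 ^ 2
        - (R.lam 3 + R.lam 4 + R.lam 5) * (R.lam 1 + R.lam 2)
        + (R.lam 3 * R.lam 4 + R.lam 4 * R.lam 5 + R.lam 3 * R.lam 5)))

theorem glE_row_mul_mul_col : R.glE 2 0 * (R.glE 0 0 * R.glE 0 2 + R.glE 0 1 * R.glE 1 2) +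
    R.glE 2 1 * (R.glE 1 0 * R.glE 0 2 + R.glE 1 1 * R.glE 1 2) = R.co R.v := by
  rw [v, co_neg, ← V_eq]
  simp [glE, smul_smul, D1, D2, mul_add, mul_sub]
  abel

theorem trace_glE_sq : ∑ i, ∑ j, R.glE i j * R.glE j i =
    R.co ((R.lam 3 + R.lam 4 + R.lam 5) ^ 2 -
      2 * (R.lam 3 * R.lam 4 + R.lam 4 * R.lam 5 + R.lam 3 * R.lam 5) - 2) := by
  obtain ⟨h0, h1, h2⟩ := R.glE_diag
  rw [trace_sq_of_lie R.lie_glE, glE_row_mul_col, glE_zero_one_mul, glE_one_zero_mul, h0, h1, h2,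
    D1, D2, D3, co_ofNat R 2]
  simp only [← co_neg, co_mul_co, ← co_add, ← co_sub, w]
  congr 1
  ring

theorem trace_glE_cube : ∑ i, ∑ j, ∑ k, R.glE i j * R.glE j k * R.glE k i =
    R.co ((R.lam 3 + R.lam 4 + R.lam 5) ^ 3 -
      3 * (R.lam 3 + R.lam 4 + R.lam 5) *
        (R.lam 3 * R.lam 4 + R.lam 4 * R.lam 5 + R.lam 3 * R.lam 5) +
      3 * (R.lam 3 * R.lam 4 * R.lam 5) + (R.lam 3 + R.lam 4 + R.lam 5) ^ 2 -
      3 * (R.lam 3 * R.lam 4 + R.lam 4 * R.lam 5 + R.lam 3 * R.lam 5) -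
      2 * (R.lam 3 + R.lam 4 + R.lam 5) - 3) := by
  obtain ⟨h0, h1, h2⟩ := R.glE_diag
  rw [trace_cube_of_lie R.lie_glE, glE_row_mul_col, glE_row_mul_mul_col, glE_zero_one_mul,
    glE_one_zero_mul, h0, h1, h2, D1, D2, D3, co_ofNat R 2, co_ofNat R 3, co_ofNat R 4, ← R.co_one]
  simp only [← co_neg, co_mul_co, ← co_add, ← co_sub, w, v]
  congr 1
  ring

end ShiftRing

/-! ### Traceless matrices and their Casimir elements -/

section Covariant

variable {n B : Type} [Fintype n] [DecidableEq n] [Ring B] {e : Matrix n n B}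

/-- A matrix that transforms like `e` under the adjoint action of the entries of `e`. -/
def IsCovariant (e M : Matrix n n B) : Prop :=
  ∀ k l i j, ⁅e k l, M i j⁆ = (if l = i then M k j else 0) - (if j = k then M i l else 0)

/-- The bracket is a derivation, and the two terms from the contracted index, -MᵢₗNₖⱼ and +MᵢₗNₖⱼ,
cancel. -/
theorem IsCovariant.mul {M N : Matrix n n B} (hM : IsCovariant e M) (hN : IsCovariant e N) :
    IsCovariant e (M * N) := by
  intro k l i j
  have h (a b c : B) : ⁅a, b * c⁆ = ⁅a, b⁆ * c + b * ⁅a, c⁆ := by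
    simp only [Ring.lie_def]
    noncomm_ring
  simp only [Matrix.mul_apply, lie_sum, h, hM k l, hN k l, sub_mul, mul_sub, ite_mul, mul_ite,
    zero_mul, mul_zero, Finset.sum_add_distrib, Finset.sum_sub_distrib, Finset.sum_ite_eq,
    Finset.sum_ite_eq', Finset.mem_univ, if_true]
  split_ifs <;> simp
  abel

theorem IsCovariant.lie_trace {M : Matrix n n B} (hM : IsCovariant e M) (k l : n) :
    ⁅e k l, M.trace⁆ = 0 := by
  simp [Matrix.trace, lie_sum, hM k l]

end Covariant

namespace SU3

/-- The traceless part of the matrix unit `Eᵢⱼ`. -/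
noncomputable def unit (i j : Fin 3) : sl3 :=
  ⟨Matrix.single i j 1 - (if i = j then (1 / 3 : ℂ) else 0) • 1, by
    rw [LieAlgebra.SpecialLinear.sl, LieSubalgebra.mem_mk_iff', LinearMap.mem_ker]
    by_cases h : i = j <;> simp [h, Matrix.trace_single_eq_of_ne]⟩

/-- Scalar parts do not affect the bracket, and in Eᵢᵢ - Eⱼⱼ they cancel, so the traceless parts
keep the relations of the matrix units. -/
theorem lie_unit (i j k l : Fin 3) : ⁅unit i j, unit k l⁆ =
    (if j = k then unit i l else 0) - (if l = i then unit k j else 0) := by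
  apply Subtype.ext
  rw [LieSubalgebra.coe_bracket, Ring.lie_def]
  have h : (unit i j).1 * (unit k l).1 - (unit k l).1 * (unit i j).1 =
      Matrix.single i j 1 * Matrix.single k l 1 - Matrix.single k l 1 * Matrix.single i j 1 := by
    simp only [unit, sub_mul, mul_sub, smul_mul_assoc, mul_smul_comm, one_mul, mul_one]
    module
  rw [h]
  by_cases h1 : j = k <;> by_cases h2 : l = i
  · subst h1 h2
    by_cases h3 : l = j <;> simp [unit, h3]
  · subst h1
    simp [unit, h2, Ne.symm h2]
  · subst h2
    simp [unit, h1, Ne.symm h1, Matrix.single_mul_single_of_ne]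
  · simp [h1, h2, Matrix.single_mul_single_of_ne]

theorem sum_unit_diag : ∑ i, unit i i = 0 := by
  apply Subtype.ext
  simp only [Fin.sum_univ_three, unit]
  ext i j
  fin_cases i <;> fin_cases j <;> simp <;> norm_num

theorem eq_sum_unit (x : sl3) : x = ∑ i, ∑ j, (x : Matrix (Fin 3) (Fin 3) ℂ) i j • unit i j := by
  have hx : (x : Matrix (Fin 3) (Fin 3) ℂ).trace = 0 := x.2
  rw [Matrix.trace_fin_three] at hx
  apply Subtype.ext
  ext i j
  simp only [Fin.sum_univ_three, unit]
  fin_cases i <;> fin_cases j <;> simp <;> linear_combination (1 / 3 : ℂ) * hx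

/-- The combinations of matrix entries that appear in the Gell-Mann matrices. -/
noncomputable def gellMann {V : Type} [AddCommGroup V] [Module ℂ V] (p : Fin 3 → Fin 3 → V) :
    Fin 8 → V :=
  ![p 0 1 + p 1 0, Complex.I • (p 1 0 - p 0 1), p 0 0 - p 1 1, p 2 0 + p 0 2,
    Complex.I • (p 2 0 - p 0 2), p 2 1 + p 1 2, Complex.I • (p 2 1 - p 1 2),
    ((1 / Real.sqrt 3 : ℝ) : ℂ) • (p 0 0 + p 1 1 - (2 : ℂ) • p 2 2)]

theorem F_eq : F = gellMann unit := by
  funext k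
  apply Subtype.ext
  ext i j
  fin_cases k <;> fin_cases i <;> fin_cases j <;>
    simp [F, gellMannMatrix, gellMann, unit] <;> ring

theorem inv_sqrt_three_mul_self :
    ((1 / Real.sqrt 3 : ℝ) : ℂ) * ((1 / Real.sqrt 3 : ℝ) : ℂ) = 1 / 3 := by
  rw [← Complex.ofReal_mul, div_mul_div_comm, Real.mul_self_sqrt (by norm_num)]
  norm_num

section Sum

variable {B : Type} [Ring B] [Algebra ℂ B]

/-- The Gell-Mann basis is orthogonal for the trace form, with norm 2. Only `p` has to be traceless,
which allows `q` to be a symmetrized square later. -/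
theorem sum_gellMann_mul_gellMann (p q : Matrix (Fin 3) (Fin 3) B) (hp : ∑ i, p i i = 0) :
    ∑ k, gellMann p k * gellMann q k = (2 : ℂ) • ∑ i, ∑ j, p i j * q j i := by
  have h2 : p 2 2 = -(p 0 0 + p 1 1) := by
    rw [Fin.sum_univ_three] at hp
    rw [eq_neg_iff_add_eq_zero, add_comm, hp]
  have hs := inv_sqrt_three_mul_self
  simp only [Fin.sum_univ_eight, Fin.sum_univ_three, gellMann, Matrix.cons_val, h2]
  generalize ((1 / Real.sqrt 3 : ℝ) : ℂ) = s at hs ⊢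
  simp only [smul_mul_assoc, mul_smul_comm, smul_smul, hs, Complex.I_mul_I]
  simp only [mul_add, add_mul, mul_sub, sub_mul, neg_mul, smul_mul_assoc, mul_smul_comm]
  module

/-- Both summation orders of the product of a matrix with itself. -/
def symmSquare (p : Matrix (Fin 3) (Fin 3) B) : Matrix (Fin 3) (Fin 3) B :=
  fun i j => ∑ k, (p i k * p k j + p k j * p i k)

end Sum

end SU3

/-! ### Contractions with the symmetric tensor -/

namespace SU3

-- With an arbitrary table `g` in place of products, the 512 values of `d` are unfolded only once.
set_option maxHeartbeats 1000000 in
theorem sum_d_smul {V : Type} [AddCommGroup V] [Module ℂ V] (g : Fin 8 → Fin 8 → V) (j : Fin 8) :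
    ∑ k, ∑ l, d j k l • g k l =
      ![(1 / 2 : ℂ) • (g 3 5 + g 5 3 + (g 4 6 + g 6 4)) +
          ((1 / Real.sqrt 3 : ℝ) : ℂ) • (g 0 7 + g 7 0),
        (1 / 2 : ℂ) • (g 4 5 + g 5 4 - (g 3 6 + g 6 3)) +
          ((1 / Real.sqrt 3 : ℝ) : ℂ) • (g 1 7 + g 7 1),
        (1 / 2 : ℂ) • (g 3 3 + g 4 4 - (g 5 5 + g 6 6)) +
          ((1 / Real.sqrt 3 : ℝ) : ℂ) • (g 2 7 + g 7 2),
        (1 / 2 : ℂ) • (g 0 5 + g 5 0 - (g 1 6 + g 6 1) + (g 2 3 + g 3 2) -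
          ((1 / Real.sqrt 3 : ℝ) : ℂ) • (g 3 7 + g 7 3)),
        (1 / 2 : ℂ) • (g 0 6 + g 6 0 + (g 1 5 + g 5 1) + (g 2 4 + g 4 2) -
          ((1 / Real.sqrt 3 : ℝ) : ℂ) • (g 4 7 + g 7 4)),
        (1 / 2 : ℂ) • (g 0 3 + g 3 0 + (g 1 4 + g 4 1) - (g 2 5 + g 5 2) -
          ((1 / Real.sqrt 3 : ℝ) : ℂ) • (g 5 7 + g 7 5)),
        (1 / 2 : ℂ) • (g 0 4 + g 4 0 - (g 1 3 + g 3 1) - (g 2 6 + g 6 2) -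
          ((1 / Real.sqrt 3 : ℝ) : ℂ) • (g 6 7 + g 7 6)),
        ((1 / Real.sqrt 3 : ℝ) : ℂ) • (g 0 0 + g 1 1 + g 2 2 - g 7 7 -
          (1 / 2 : ℂ) • (g 3 3 + g 4 4 + g 5 5 + g 6 6))] j := by
  fin_cases j <;> simp [-Complex.coe_smul, Fin.sum_univ_eight, d, dIndep] <;> module

variable {B : Type} [Ring B] [Algebra ℂ B]

/-- The tensor d encodes the anticommutator of Gell-Mann matrices. Its scalar part is invisible
here, because no Gell-Mann component sees multiples of the identity. -/
theorem sum_d_smul_gellMann (p : Matrix (Fin 3) (Fin 3) B) (hp : ∑ i, p i i = 0) (j : Fin 8) :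
    ∑ k, ∑ l, d j k l • (gellMann p k * gellMann p l) = gellMann (symmSquare p) j := by
  have h2 : p 2 2 = -(p 0 0 + p 1 1) := by
    rw [Fin.sum_univ_three] at hp
    rw [eq_neg_iff_add_eq_zero, add_comm, hp]
  have hs := inv_sqrt_three_mul_self
  have h7 : gellMann p 7 = ((1 / Real.sqrt 3 : ℝ) : ℂ) • ((3 : ℂ) • (p 0 0 + p 1 1)) := by
    simp only [gellMann, Matrix.cons_val, h2]
    module
  rw [sum_d_smul (fun k l => gellMann p k * gellMann p l)]
  rw [gellMann.eq_def (symmSquare p)]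
  -- The last component becomes s • w with s = 1/√3, so that s² = 1/3 is the only fact about the
  -- root that is used.
  generalize hw : (3 : ℂ) • (p 0 0 + p 1 1) = w at h7
  simp only [h7]
  generalize ((1 / Real.sqrt 3 : ℝ) : ℂ) = s at hs ⊢
  simp only [smul_mul_assoc, mul_smul_comm, ← smul_add, smul_smul s s, hs]
  subst hw
  fin_cases j <;>
    (simp [gellMann, symmSquare, Fin.sum_univ_three, h2, -Complex.coe_smul]
     simp only [mul_add, add_mul, mul_sub, sub_mul, neg_mul, mul_neg, smul_mul_assoc,
      mul_smul_comm, smul_smul, Complex.I_mul_I]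
     module)

end SU3

/-! ### The quadratic and the cubic element -/

section Trace

variable {B : Type} [Ring B]

/-- Exchanging mₖⱼmᵢₖ costs -mᵢⱼ for each of the three values of k, and a multiple of the trace,
which vanishes. -/
theorem symmSquare_of_lie {m : Matrix (Fin 3) (Fin 3) B} (h : ∀ i j k l, ⁅m i j, m k l⁆ =
    (if j = k then m i l else 0) - (if l = i then m k j else 0)) (hm : ∑ i, m i i = 0)
    (i j : Fin 3) :
    SU3.symmSquare m i j = 2 * ∑ k, m i k * m k j - 3 * m i j := by
  have h' (k : Fin 3) : m k j * m i k =
      m i k * m k j - m i j + if j = i then m k k else 0 := by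
    have := h i k k j
    rw [Ring.lie_def, if_pos rfl] at this
    rw [sub_add, ← this, sub_sub_cancel]
  have hd : ∑ k : Fin 3, (if j = i then m k k else 0) = 0 := by
    split_ifs
    · exact hm
    · simp
  simp only [SU3.symmSquare, h', Finset.sum_add_distrib, Finset.sum_sub_distrib, hd]
  simp
  noncomm_ring

end Trace

namespace SU3

section Sum

variable {B : Type} [Ring B] [Algebra ℂ B]

/-- `¼ ∑ g_k g_k`. -/
noncomputable def quad (g : Fin 8 → B) : B := (1 / 4 : ℂ) • ∑ k, g k * g k

/-- `⅛ ∑ d_{jkl} g_j g_k g_l`. -/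
noncomputable def cub (g : Fin 8 → B) : B :=
  (1 / 8 : ℂ) • ∑ j, ∑ k, ∑ l, d j k l • (g j * g k * g l)

theorem quad_gellMann {m : Matrix (Fin 3) (Fin 3) B} (hm : ∑ i, m i i = 0) :
    quad (gellMann m) = (1 / 2 : ℂ) • ∑ i, ∑ j, m i j * m j i := by
  rw [quad, sum_gellMann_mul_gellMann m m hm, smul_smul]
  norm_num

/-- Contracting d gives the symmetrized square 2m² - 3m; pairing it with m yields (1/8) · 2 · (2 tr
m³ - 3 tr m²). -/
theorem cub_gellMann {m : Matrix (Fin 3) (Fin 3) B} (h : ∀ i j k l, ⁅m i j, m k l⁆ =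
    (if j = k then m i l else 0) - (if l = i then m k j else 0)) (hm : ∑ i, m i i = 0) :
    cub (gellMann m) = (1 / 2 : ℂ) • ∑ i, ∑ j, ∑ k, m i j * m j k * m k i -
      (3 / 4 : ℂ) • ∑ i, ∑ j, m i j * m j i := by
  have h1 : ∑ j, ∑ k, ∑ l, d j k l • (gellMann m j * gellMann m k * gellMann m l) =
      ∑ j, gellMann m j * gellMann (symmSquare m) j := by
    refine Finset.sum_congr rfl fun j _ => ?_
    rw [← sum_d_smul_gellMann m hm j]
    simp only [Finset.mul_sum, mul_smul_comm, mul_assoc]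
  rw [cub, h1, sum_gellMann_mul_gellMann m _ hm, smul_smul]
  have h2 : ∑ i, ∑ j, m i j * symmSquare m j i =
      (2 : ℂ) • ∑ i, ∑ j, ∑ k, m i j * m j k * m k i - (3 : ℂ) • ∑ i, ∑ j, m i j * m j i := by
    simp only [symmSquare_of_lie h hm, Finset.smul_sum, ← Finset.sum_sub_distrib]
    refine Finset.sum_congr rfl fun i _ => Finset.sum_congr rfl fun j _ => ?_
    simp only [mul_assoc, ← Finset.mul_sum, ← Finset.smul_sum, ofNat_smul_eq_nsmul]
    noncomm_ring
  rw [h2]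
  module

theorem cub_I_smul (g : Fin 8 → B) :
    cub (fun k => Complex.I • g k) = -Complex.I • cub g := by
  simp only [cub, smul_comm (-Complex.I), Finset.smul_sum]
  simp only [smul_mul_assoc, mul_smul_comm, smul_smul, Complex.I_mul_I]
  refine Finset.sum_congr rfl fun j _ => Finset.sum_congr rfl fun k _ =>
    Finset.sum_congr rfl fun l _ => ?_
  congr 1
  ring

theorem map_quad {B' : Type} [Ring B'] [Algebra ℂ B'] (f : B →ₐ[ℂ] B') (g : Fin 8 → B) :
    f (quad g) = quad fun k => f (g k) := by simp [quad]

theorem map_cub {B' : Type} [Ring B'] [Algebra ℂ B'] (f : B →ₐ[ℂ] B') (g : Fin 8 → B) :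
    f (cub g) = cub fun k => f (g k) := by simp [cub]

theorem map_gellMann {V W : Type} [AddCommGroup V] [Module ℂ V] [AddCommGroup W] [Module ℂ W]
    (f : V →ₗ[ℂ] W) (p : Fin 3 → Fin 3 → V) (k : Fin 8) :
    f (gellMann p k) = gellMann (fun i j => f (p i j)) k := by
  fin_cases k <;> simp [gellMann, -Complex.coe_smul]

end Sum

end SU3

/-! ### Centrality of the Casimir elements -/

namespace SU3

/-- The generators of the enveloping algebra that come from the matrix units. -/
noncomputable def unitU : Matrix (Fin 3) (Fin 3) U := fun i j => toU (unit i j)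

theorem lie_unitU (i j k l : Fin 3) : ⁅unitU i j, unitU k l⁆ =
    (if j = k then unitU i l else 0) - (if l = i then unitU k j else 0) := by
  have h : ⁅unitU i j, unitU k l⁆ = toU ⁅unit i j, unit k l⁆ := (LieHom.map_lie toU _ _).symm
  rw [h, lie_unit, map_sub]
  split_ifs <;> simp [unitU]

theorem sum_unitU : ∑ i, unitU i i = 0 := by
  simp only [unitU, ← map_sum, sum_unit_diag, map_zero]

theorem isCovariant_unitU : IsCovariant unitU unitU := by
  intro k l i j
  rw [lie_unitU]

theorem toU_F (k : Fin 8) : toU (F k) = gellMann unitU k := by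
  rw [F_eq]
  exact map_gellMann (toU : sl3 →ₗ[ℂ] U) unit k

theorem quadratic_F : quadratic F = quad (gellMann unitU) := by
  simp only [quadratic, quad, toU_F]

theorem cubic_F : cubic F = cub (gellMann unitU) := by
  simp only [cubic, cub, toU_F]

theorem cubic_I_smul_F : cubic (fun k => Complex.I • F k) = -Complex.I • cubic F := by
  rw [cubic_F, ← cub_I_smul]
  simp only [cubic, cub, map_smul, toU_F]

/-- The centralizer of c contains the image of the Lie algebra, so the inclusion lifts to it. By
uniqueness of lifts, that lift followed by the inclusion is the identity of U, hence the centralizer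
is all of U. -/
theorem mem_center_of_commute {c : U} (h : ∀ x, Commute (toU x) c) :
    c ∈ Subalgebra.center ℂ U := by
  let S : Subalgebra ℂ U := Subalgebra.centralizer ℂ {c}
  have hS (x : sl3) : toU x ∈ S := by
    rw [Subalgebra.mem_centralizer_iff]
    rintro _ rfl
    exact (h x).symm
  let g : sl3 →ₗ⁅ℂ⁆ S :=
    { toFun := fun x => ⟨toU x, hS x⟩
      map_add' := fun x y => Subtype.ext (map_add toU x y)
      map_smul' := fun a x => Subtype.ext (map_smul toU a x)
      map_lie' := fun {x y} => Subtype.ext (LieHom.map_lie toU x y) }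
  have hid : S.val.comp (UniversalEnvelopingAlgebra.lift ℂ g) = AlgHom.id ℂ U := by
    apply UniversalEnvelopingAlgebra.hom_ext
    ext x
    change S.val (UniversalEnvelopingAlgebra.lift ℂ g (UniversalEnvelopingAlgebra.ι ℂ x)) = _
    rw [UniversalEnvelopingAlgebra.lift_ι_apply]
    rfl
  rw [Subalgebra.mem_center_iff]
  intro b
  have hb : b ∈ S := by
    have := DFunLike.congr_fun hid b
    rw [AlgHom.id_apply] at this
    rw [← this]
    exact (UniversalEnvelopingAlgebra.lift ℂ g b).2
  exact ((Subalgebra.mem_centralizer_iff ℂ).1 hb c rfl).symm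

theorem mem_center_of_lie {c : U} (h : ∀ i j, ⁅unitU i j, c⁆ = 0) :
    c ∈ Subalgebra.center ℂ U := by
  apply mem_center_of_commute
  intro x
  rw [eq_sum_unit x]
  simp only [map_sum, map_smul]
  refine Commute.sum_left _ _ _ fun i _ => Commute.sum_left _ _ _ fun j _ => ?_
  apply Commute.smul_left
  have := h i j
  rw [Ring.lie_def, sub_eq_zero] at this
  exact this

theorem sum_sq_mem_center :
    ∑ i, ∑ j, unitU i j * unitU j i ∈ Subalgebra.center ℂ U :=
  mem_center_of_lie fun k l =>
    (isCovariant_unitU.mul isCovariant_unitU).lie_trace k l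

theorem sum_cube_mem_center :
    ∑ i, ∑ j, ∑ k, unitU i j * unitU j k * unitU k i ∈ Subalgebra.center ℂ U := by
  have h : ∑ i, ∑ j, ∑ k, unitU i j * unitU j k * unitU k i =
      (unitU * unitU * unitU).trace := by
    simp only [Matrix.trace, Matrix.diag, Matrix.mul_apply, Finset.sum_mul]
    exact Finset.sum_congr rfl fun i _ => Finset.sum_comm
  rw [h]
  exact mem_center_of_lie
    ((isCovariant_unitU.mul isCovariant_unitU).mul isCovariant_unitU).lie_trace

theorem quadratic_F_mem_center : quadratic F ∈ Subalgebra.center ℂ U := by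
  rw [quadratic_F, quad_gellMann sum_unitU]
  exact Subalgebra.smul_mem _ sum_sq_mem_center _

theorem cubic_F_mem_center : cubic F ∈ Subalgebra.center ℂ U := by
  rw [cubic_F, cub_gellMann lie_unitU sum_unitU]
  exact Subalgebra.sub_mem _ (Subalgebra.smul_mem _ sum_cube_mem_center _)
    (Subalgebra.smul_mem _ sum_sq_mem_center _)

end SU3

/-! ### Representations of the traceless matrices by `gl₃` matrices -/

section Hom

variable {n B : Type} [Fintype n] [DecidableEq n] [Ring B] [Algebra ℂ B]

theorem lie_sum_smul {e : Matrix n n B} (h : ∀ i j k l, ⁅e i j, e k l⁆ =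
    (if j = k then e i l else 0) - (if l = i then e k j else 0)) (M N : Matrix n n ℂ) :
    ⁅∑ i, ∑ j, M i j • e i j, ∑ k, ∑ l, N k l • e k l⁆ =
      ∑ i, ∑ j, (M * N - N * M) i j • e i j := by
  have h1 (i j k l : n) : ⁅M i j • e i j, N k l • e k l⁆ =
      (if j = k then (M i j * N k l) • e i l else 0) -
        (if l = i then (N k l * M i j) • e k j else 0) := by
    rw [smul_lie, lie_smul, h, smul_smul, smul_sub, mul_comm (N k l)]
    simp
  simp only [Matrix.sub_apply, Matrix.mul_apply, sub_smul, Finset.sum_smul,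
    Finset.sum_sub_distrib, sum_lie]
  simp only [lie_sum, h1, Finset.sum_sub_distrib]
  congr 1
  · refine Finset.sum_congr rfl fun i _ => ?_
    conv_rhs => rw [Finset.sum_comm]
    refine Finset.sum_congr rfl fun j _ => ?_
    rw [Finset.sum_comm]
    simp
  · simp only [Finset.sum_ite_eq', Finset.mem_univ, if_true]
    rw [Finset.sum_comm]
    conv_rhs => rw [Finset.sum_comm]
    exact Finset.sum_congr rfl fun j _ => Finset.sum_comm

/-- The Lie algebra homomorphism that sends the matrix units to the entries of `e`. -/
def matrixLieHom (e : Matrix n n B) (h : ∀ i j k l, ⁅e i j, e k l⁆ =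
    (if j = k then e i l else 0) - (if l = i then e k j else 0)) :
    Matrix n n ℂ →ₗ⁅ℂ⁆ B where
  toFun M := ∑ i, ∑ j, M i j • e i j
  map_add' M N := by simp [add_smul, Finset.sum_add_distrib]
  map_smul' c M := by simp [Finset.smul_sum, smul_smul]
  map_lie' {M N} := (lie_sum_smul h M N).symm

theorem matrixLieHom_apply (e : Matrix n n B) (h) (M : Matrix n n ℂ) :
    matrixLieHom e h M = ∑ i, ∑ j, M i j • e i j := rfl

theorem matrixLieHom_single (e : Matrix n n B) (h) (i j : n) :
    matrixLieHom e h (Matrix.single i j 1) = e i j := by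
  rw [matrixLieHom_apply]
  simp [Matrix.single_apply, ite_and]

theorem matrixLieHom_one (e : Matrix n n B) (h) :
    matrixLieHom e h 1 = ∑ i, e i i := by
  rw [matrixLieHom_apply]
  simp [Matrix.one_apply]

end Hom

section Traceless

variable {B : Type} [Ring B] {e : Matrix (Fin 3) (Fin 3) B}

theorem sum_diag_commute (h : ∀ i j k l, ⁅e i j, e k l⁆ =
    (if j = k then e i l else 0) - (if l = i then e k j else 0)) (i j : Fin 3) :
    (∑ k, e k k) * e i j = e i j * ∑ k, e k k := by
  have h' : ⁅∑ k, e k k, e i j⁆ = 0 := by simp [sum_lie, h]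
  rwa [Ring.lie_def, sub_eq_zero] at h'

variable [Algebra ℂ B]

/-- The traceless part of a matrix with coefficients in an algebra. -/
noncomputable def traceless (e : Matrix (Fin 3) (Fin 3) B) : Matrix (Fin 3) (Fin 3) B :=
  fun i j => e i j - (if i = j then (1 / 3 : ℂ) else 0) • ∑ k, e k k

theorem sum_traceless_mul (h : ∀ i j k l, ⁅e i j, e k l⁆ =
    (if j = k then e i l else 0) - (if l = i then e k j else 0)) :
    ∑ i, ∑ j, traceless e i j * traceless e j i =
      ∑ i, ∑ j, e i j * e j i - (1 / 3 : ℂ) • ((∑ k, e k k) * ∑ k, e k k) := by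
  have hc := sum_diag_commute h
  have hs := Fin.sum_univ_three (fun k => e k k)
  simp only [traceless]
  generalize ∑ k, e k k = c at hc hs ⊢
  have h2 : e 2 2 = c - e 0 0 - e 1 1 := by rw [hs]; abel
  simp [Fin.sum_univ_three, mul_sub, sub_mul, hc]
  simp only [h2, mul_sub, sub_mul, hc]
  module

/-- The trace c is central, so this is the expansion of tr (e - c/3)³; the coefficient 2/9 is 3 ·
(1/9) - 3 · (1/27). -/
theorem sum_traceless_mul_mul (h : ∀ i j k l, ⁅e i j, e k l⁆ =
    (if j = k then e i l else 0) - (if l = i then e k j else 0)) :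
    ∑ i, ∑ j, ∑ k, traceless e i j * traceless e j k * traceless e k i =
      ∑ i, ∑ j, ∑ k, e i j * e j k * e k i - (∑ i, ∑ j, e i j * e j i) * (∑ k, e k k)
        + (2 / 9 : ℂ) • ((∑ k, e k k) * (∑ k, e k k) * ∑ k, e k k) := by
  have hc := sum_diag_commute h
  have hs := Fin.sum_univ_three (fun k => e k k)
  simp only [traceless]
  generalize ∑ k, e k k = c at hc hs ⊢
  have h2 : e 2 2 = c - e 0 0 - e 1 1 := by rw [hs]; abel
  have hcc (i j : Fin 3) (b : B) : c * (e i j * b) = e i j * (c * b) := by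
    rw [← mul_assoc, hc, mul_assoc]
  simp [Fin.sum_univ_three, mul_sub, sub_mul, add_mul, mul_assoc, hc, hcc]
  simp only [h2, mul_sub, sub_mul, hc, hcc]
  module

end Traceless

namespace SU3

/-! ### The structure of the Lie algebra of traceless matrices -/

/-- Since tr(FⱼFₖ) = 2δⱼₖ, the k-th coefficient is ½ tr(xFₖ); the transpose comes from this pairing.
-/
theorem eq_sum_F (x : sl3) : x = ∑ k, ((1 / 2 : ℂ) *
    gellMann (fun i j => (x : Matrix (Fin 3) (Fin 3) ℂ) j i) k) • F k := by
  have hx : (x : Matrix (Fin 3) (Fin 3) ℂ).trace = 0 := x.2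
  rw [Matrix.trace_fin_three] at hx
  have h2 := eq_neg_of_add_eq_zero_right hx
  have hs := inv_sqrt_three_mul_self
  apply Subtype.ext
  ext i j
  rw [Fin.sum_univ_eight]
  change x.1 i j = (_ • gellMannMatrix 0 + _ • gellMannMatrix 1 + _ • gellMannMatrix 2 +
    _ • gellMannMatrix 3 + _ • gellMannMatrix 4 + _ • gellMannMatrix 5 + _ • gellMannMatrix 6 +
    _ • gellMannMatrix 7 : Matrix (Fin 3) (Fin 3) ℂ) i j
  simp only [gellMann, gellMannMatrix]
  generalize ((1 / Real.sqrt 3 : ℝ) : ℂ) = s at hs ⊢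
  fin_cases i <;> fin_cases j <;> simp [h2] <;> ring_nf <;>
    simp only [Complex.I_sq, pow_two s, hs] <;> ring

/-- For E = Eₖₗ with k ≠ l, E² = 0 leaves only -2ExE in the double bracket, which isolates one
off-diagonal entry of x. -/
theorem lie_unit_lie_unit {k l : Fin 3} (hkl : k ≠ l) (x : sl3) :
    ⁅unit k l, ⁅unit k l, x⁆⁆ = (-2 * (x : Matrix (Fin 3) (Fin 3) ℂ) l k) • unit k l := by
  apply Subtype.ext
  have h : (unit k l : Matrix (Fin 3) (Fin 3) ℂ) = Matrix.single k l 1 := by simp [unit, hkl]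
  have h1 : Matrix.single k l (1 : ℂ) * Matrix.single k l 1 = 0 :=
    Matrix.single_mul_single_of_ne _ _ _ _ hkl.symm _
  have h2 : Matrix.single k l (1 : ℂ) * x.1 * Matrix.single k l 1 =
      x.1 l k • Matrix.single k l 1 := by
    simp
  have h3 (a b : Matrix (Fin 3) (Fin 3) ℂ) : a * (a * b - b * a) - (a * b - b * a) * a =
      a * a * b - a * b * a - (a * b * a - b * (a * a)) := by noncomm_ring
  rw [LieSubalgebra.coe_bracket, LieSubalgebra.coe_bracket, Ring.lie_def, Ring.lie_def, h, h3, h1,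
    h2, zero_mul, mul_zero]
  change _ = (-2 * x.1 l k) • (unit k l : Matrix (Fin 3) (Fin 3) ℂ)
  rw [h]
  module

theorem lie_unit_of_diag {k l : Fin 3} (hkl : k ≠ l) (x : sl3)
    (hx : ∀ i j, i ≠ j → (x : Matrix (Fin 3) (Fin 3) ℂ) i j = 0) :
    ⁅unit k l, x⁆ = ((x : Matrix (Fin 3) (Fin 3) ℂ) l l - x.1 k k) • unit k l := by
  apply Subtype.ext
  have h : (unit k l : Matrix (Fin 3) (Fin 3) ℂ) = Matrix.single k l 1 := by simp [unit, hkl]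
  have hd : x.1 = Matrix.diagonal fun i => x.1 i i := by
    ext i j
    by_cases hij : i = j
    · simp [hij]
    · simp [hij, hx i j hij]
  rw [LieSubalgebra.coe_bracket, Ring.lie_def]
  change _ = (x.1 l l - x.1 k k) • (unit k l : Matrix (Fin 3) (Fin 3) ℂ)
  rw [h]
  generalize x.1 = y at hd
  rw [hd]
  ext a b
  rw [Matrix.sub_apply, Matrix.mul_diagonal, Matrix.diagonal_mul, Matrix.smul_apply,
    Matrix.diagonal_apply_eq, Matrix.diagonal_apply_eq, Matrix.single_apply]
  split_ifs with hab
  · obtain ⟨rfl, rfl⟩ := hab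
    simp
  · simp

/-! ### Injectivity, range and Casimir values for a general gl₃ matrix -/

section Hom

variable {B : Type} [Ring B] [Algebra ℂ B]

/-- Double brackets with Eₖₗ show that an element of the kernel is diagonal, single brackets that
its diagonal entries agree, and the trace condition that they vanish. -/
theorem injective_of_unit_ne_zero (f : sl3 →ₗ⁅ℂ⁆ B)
    (hf : ∀ k l, k ≠ l → f (unit k l) ≠ 0) : Function.Injective f := by
  refine (injective_iff_map_eq_zero f).2 fun x hx => ?_
  have hoff (i j : Fin 3) (hij : i ≠ j) : x.1 i j = 0 := by
    have h := congrArg f (lie_unit_lie_unit hij.symm x)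
    rw [LieHom.map_lie, LieHom.map_lie, hx, lie_zero, lie_zero, map_smul] at h
    simpa [hf j i hij.symm] using h.symm
  have hdiag (k l : Fin 3) (hkl : k ≠ l) : x.1 l l = x.1 k k := by
    have h := congrArg f (lie_unit_of_diag hkl x hoff)
    rw [LieHom.map_lie, hx, lie_zero, map_smul] at h
    simpa [hf k l hkl, sub_eq_zero] using h.symm
  have ht : x.1.trace = 0 := x.2
  rw [Matrix.trace_fin_three, hdiag 0 1 (by decide), hdiag 0 2 (by decide)] at ht
  have h0 : x.1 0 0 = 0 := by linear_combination (1 / 3 : ℂ) * ht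
  apply Subtype.ext
  ext i j
  by_cases hij : i = j
  · subst hij
    by_cases hi : i = 0
    · simpa [hi] using h0
    · rw [hdiag 0 i (Ne.symm hi), h0]
      rfl
  · exact hoff i j hij

/-- The representation of the traceless matrices by a `gl₃` matrix. -/
def slHom (e : Matrix (Fin 3) (Fin 3) B) (h : ∀ i j k l, ⁅e i j, e k l⁆ =
    (if j = k then e i l else 0) - (if l = i then e k j else 0)) : sl3 →ₗ⁅ℂ⁆ B :=
  (matrixLieHom e h).comp (LieSubalgebra.incl _)

variable {e : Matrix (Fin 3) (Fin 3) B}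

theorem slHom_apply (h : ∀ i j k l, ⁅e i j, e k l⁆ =
    (if j = k then e i l else 0) - (if l = i then e k j else 0))
    (x : sl3) :
    slHom e h x = ∑ i, ∑ j, (x : Matrix (Fin 3) (Fin 3) ℂ) i j • e i j := rfl

theorem slHom_unit (h : ∀ i j k l, ⁅e i j, e k l⁆ =
    (if j = k then e i l else 0) - (if l = i then e k j else 0))
    (i j : Fin 3) : slHom e h (unit i j) = traceless e i j := by
  change matrixLieHom e h (Matrix.single i j 1 - (if i = j then (1 / 3 : ℂ) else 0) • 1) = _
  rw [map_sub, map_smul, matrixLieHom_single, matrixLieHom_one, traceless]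

theorem slHom_F (h : ∀ i j k l, ⁅e i j, e k l⁆ =
    (if j = k then e i l else 0) - (if l = i then e k j else 0))
    (k : Fin 8) : slHom e h (F k) = gellMann e k := by
  fin_cases k <;>
    simp [slHom_apply, F, gellMannMatrix, gellMann, Fin.sum_univ_three, -Complex.coe_smul] <;> module

/-- If Eₖₗ were sent to 0, so would be [Eₖₗ, Eₗₖ] = Eₖₖ - Eₗₗ. -/
theorem slHom_injective (h : ∀ i j k l, ⁅e i j, e k l⁆ =
    (if j = k then e i l else 0) - (if l = i then e k j else 0))
    (he : ∀ k l, k ≠ l → e k k ≠ e l l) :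
    Function.Injective (slHom e h) := by
  refine injective_of_unit_ne_zero _ fun k l hkl h0 => he k l hkl ?_
  have h1 := congrArg (slHom e h) (lie_unit k l l k)
  rw [LieHom.map_lie, h0, zero_lie, if_pos rfl, if_pos rfl, map_sub, slHom_unit, slHom_unit] at h1
  simpa [traceless, sub_eq_zero, eq_comm] using h1

theorem lie_traceless (h : ∀ i j k l, ⁅e i j, e k l⁆ =
    (if j = k then e i l else 0) - (if l = i then e k j else 0))
    (i j k l : Fin 3) : ⁅traceless e i j, traceless e k l⁆ =
    (if j = k then traceless e i l else 0) - (if l = i then traceless e k j else 0) := by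
  simp only [← slHom_unit h]
  rw [← LieHom.map_lie, lie_unit, map_sub]
  split_ifs <;> simp

theorem sum_traceless (h : ∀ i j k l, ⁅e i j, e k l⁆ =
    (if j = k then e i l else 0) - (if l = i then e k j else 0)) :
    ∑ i, traceless e i i = 0 := by
  simp only [← slHom_unit h, ← map_sum, sum_unit_diag, map_zero]

theorem lift_unitU (h : ∀ i j k l, ⁅e i j, e k l⁆ =
    (if j = k then e i l else 0) - (if l = i then e k j else 0))
    (i j : Fin 3) :
    UniversalEnvelopingAlgebra.lift ℂ (slHom e h) (unitU i j) = traceless e i j := by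
  rw [← slHom_unit h]
  exact UniversalEnvelopingAlgebra.lift_ι_apply ℂ _ _

theorem lift_gellMann_unitU (h : ∀ i j k l, ⁅e i j, e k l⁆ =
    (if j = k then e i l else 0) - (if l = i then e k j else 0))
    (k : Fin 8) :
    UniversalEnvelopingAlgebra.lift ℂ (slHom e h) (gellMann unitU k) =
      gellMann (traceless e) k := by
  refine (map_gellMann (UniversalEnvelopingAlgebra.lift ℂ (slHom e h)).toLinearMap _ k).trans ?_
  congr 1
  funext i j
  exact lift_unitU h i j

theorem lift_quadratic (h : ∀ i j k l, ⁅e i j, e k l⁆ =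
    (if j = k then e i l else 0) - (if l = i then e k j else 0)) :
    UniversalEnvelopingAlgebra.lift ℂ (slHom e h) (quadratic F) =
      (1 / 2 : ℂ) • (∑ i, ∑ j, e i j * e j i - (1 / 3 : ℂ) • ((∑ k, e k k) * ∑ k, e k k)) := by
  rw [quadratic_F, map_quad]
  simp only [lift_gellMann_unitU]
  rw [quad_gellMann (sum_traceless h), sum_traceless_mul h]

theorem lift_cubic (h : ∀ i j k l, ⁅e i j, e k l⁆ =
    (if j = k then e i l else 0) - (if l = i then e k j else 0)) :
    UniversalEnvelopingAlgebra.lift ℂ (slHom e h) (cubic F) =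
      (1 / 2 : ℂ) • (∑ i, ∑ j, ∑ k, e i j * e j k * e k i -
        (∑ i, ∑ j, e i j * e j i) * (∑ k, e k k)
        + (2 / 9 : ℂ) • ((∑ k, e k k) * (∑ k, e k k) * ∑ k, e k k)) -
      (3 / 4 : ℂ) •
        (∑ i, ∑ j, e i j * e j i - (1 / 3 : ℂ) • ((∑ k, e k k) * ∑ k, e k k)) := by
  rw [cubic_F, map_cub]
  simp only [lift_gellMann_unitU]
  rw [cub_gellMann (lie_traceless h) (sum_traceless h), sum_traceless_mul h,
    sum_traceless_mul_mul h]

theorem range_slHom (h : ∀ i j k l, ⁅e i j, e k l⁆ =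
    (if j = k then e i l else 0) - (if l = i then e k j else 0)) :
    LieSubalgebra.lieSpan ℂ B (Set.range fun k => slHom e h (Complex.I • F k)) =
      (slHom e h).range := by
  apply le_antisymm
  · rw [LieSubalgebra.lieSpan_le]
    rintro _ ⟨k, rfl⟩
    exact ⟨_, rfl⟩
  · rintro _ ⟨x, rfl⟩
    have hF (k : Fin 8) : slHom e h (F k) ∈ LieSubalgebra.lieSpan ℂ B
        (Set.range fun k => slHom e h (Complex.I • F k)) := by
      have h1 := LieSubalgebra.smul_mem _ (-Complex.I) (LieSubalgebra.subset_lieSpan (R := ℂ)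
        (L := B) (s := Set.range fun k => slHom e h (Complex.I • F k)) ⟨k, rfl⟩)
      simpa [smul_smul] using h1
    change slHom e h x ∈ _
    rw [eq_sum_F x, map_sum]
    refine sum_mem fun k _ => ?_
    rw [map_smul]
    exact LieSubalgebra.smul_mem _ _ (hF k)

end Hom

end SU3

/-! ### The representation by shift operators -/

namespace ShiftRing

variable {L K B : Type} [CommRing L] [Field K] [Ring B] [Module L B] [Algebra ℂ B]
  (R : ShiftRing L K B)

/-- The entries X₃, Y₃ carry no factor -i, unlike the others. This is why F₄ and F₅ correspond to 𝒱₃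
and -𝒰₃ instead of following the pattern 𝒰, 𝒱. -/
theorem I_smul_gellMann_glE (k : Fin 8) : Complex.I • SU3.gellMann R.glE k =
    ![R.X1 + R.Y1, Complex.I • (R.Y1 - R.X1), Complex.I • (R.D1 - R.D2),
      Complex.I • (R.Y3 + R.X3), -(R.Y3 - R.X3), R.X2 + R.Y2, Complex.I • (R.Y2 - R.X2),
      ((1 / Real.sqrt 3 : ℝ) : ℂ) •
        (Complex.I • (R.D1 - R.D2) + (2 : ℂ) • Complex.I • (R.D2 - R.D3))] k := by
  fin_cases k <;> simp [SU3.gellMann, glE, smul_smul, -Complex.coe_smul] <;> module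

theorem lift_quadratic_glE {κ : ℂ →+* L}
    (hκ : ∀ (c : ℂ) (f : L), c • R.co f = R.co (κ c * f)) :
    UniversalEnvelopingAlgebra.lift ℂ (SU3.slHom R.glE R.lie_glE) (SU3.quadratic SU3.F) =
      R.co (κ (1 / 3) * ((R.lam 3 + R.lam 4 + R.lam 5) ^ 2 -
        3 * (R.lam 3 * R.lam 4 + R.lam 4 * R.lam 5 + R.lam 3 * R.lam 5) - 3)) := by
  rw [SU3.lift_quadratic, trace_glE_sq, trace_glE]
  simp only [co_mul_co, hκ, ← co_sub]
  congr 1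
  have h2 : κ (1 / 2) * 2 = 1 := by rw [← map_ofNat κ 2, ← map_mul]; norm_num
  have h3 : κ (1 / 3) * 3 = 1 := by rw [← map_ofNat κ 3, ← map_mul]; norm_num
  generalize κ (1 / 2) = a at *
  generalize κ (1 / 3) = b at *
  generalize R.lam 3 + R.lam 4 + R.lam 5 = g
  generalize R.lam 3 * R.lam 4 + R.lam 4 * R.lam 5 + R.lam 3 * R.lam 5 = g'
  linear_combination (-g' - 1 + b * g ^ 2) * h2 + (-a * g ^ 2 + g' + 1) * h3

theorem lift_cubic_glE {κ : ℂ →+* L}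
    (hκ : ∀ (c : ℂ) (f : L), c • R.co f = R.co (κ c * f)) :
    UniversalEnvelopingAlgebra.lift ℂ (SU3.slHom R.glE R.lie_glE) (SU3.cubic SU3.F) =
      R.co (κ (1 / 18) * (27 * (R.lam 3 * R.lam 4 * R.lam 5) -
        9 * (R.lam 3 * R.lam 4 + R.lam 4 * R.lam 5 + R.lam 3 * R.lam 5) *
          (R.lam 3 + R.lam 4 + R.lam 5) + 2 * (R.lam 3 + R.lam 4 + R.lam 5) ^ 3)) := by
  rw [SU3.lift_cubic, trace_glE_sq, trace_glE_cube, trace_glE]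
  simp only [co_mul_co, hκ, ← co_sub, ← co_add]
  congr 1
  -- All scalars are written through 1/36, so a single relation remains for the linear combination.
  have h2 : κ (1 / 2) = 18 * κ (1 / 36) := by rw [← map_ofNat κ 18, ← map_mul]; norm_num
  have h3 : κ (1 / 3) = 12 * κ (1 / 36) := by rw [← map_ofNat κ 12, ← map_mul]; norm_num
  have h9 : κ (2 / 9) = 8 * κ (1 / 36) := by rw [← map_ofNat κ 8, ← map_mul]; norm_num
  have h4 : κ (3 / 4) = 27 * κ (1 / 36) := by rw [← map_ofNat κ 27, ← map_mul]; norm_num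
  have h18 : κ (1 / 18) = 2 * κ (1 / 36) := by rw [← map_ofNat κ 2, ← map_mul]; norm_num
  have h36 : 36 * κ (1 / 36) = 1 := by rw [← map_ofNat κ 36, ← map_mul]; norm_num
  rw [h2, h3, h9, h4, h18]
  generalize κ (1 / 36) = a at *
  generalize R.lam 3 + R.lam 4 + R.lam 5 = g
  generalize R.lam 3 * R.lam 4 + R.lam 4 * R.lam 5 + R.lam 3 * R.lam 5 = g'
  generalize R.lam 3 * R.lam 4 * R.lam 5 = g''
  linear_combination (4 * a * g ^ 3 + 9 * a * g ^ 2) * h36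

end ShiftRing

/-! ### The algebra 𝔄 as a ring of shift operators -/

namespace SU3

open MvPolynomial

noncomputable instance : Module LL A := Module.compHom A (rho : LL →+* A)

theorem smul_eq (f : LL) (a : A) : f • a = rho f * a := rfl

theorem smul_mon_mul_smul_mon (f g : LL) (a b c a' b' c' : ℤ) :
    (f • mon a b c) * (g • mon a' b' c') =
      (f * monShift a b c g) • mon (a + a') (b + b') (c + c') := by
  rw [smul_eq, smul_eq, smul_eq, mul_assoc, ← mul_assoc (mon a b c), mon_mul_rho, map_mul,
    ← mon_mul_mon]
  simp only [mul_assoc]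

theorem rho_eq_smul_mon (f : LL) : rho f = f • mon 0 0 0 := by
  rw [mon_zero, smul_eq, mul_one]

theorem monShift_zero (f : LL) : monShift 0 0 0 f = f := by
  apply rho_injective
  have h := mon_mul_rho 0 0 0 f
  rw [mon_zero, one_mul, mul_one] at h
  exact h.symm

/-- The algebra `𝔄` as a ring of shift operators. -/
noncomputable def shiftRing : ShiftRing LL KK A where
  toK := toKK
  toK_injective := toKK_injective
  mon := mon
  shL := monShift
  shK a b c := extKK (monShift a b c)
  toK_shL a b c f := toKK_apply _ _
  shL_zero := monShift_zero
  mon_zero := mon_zero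
  smul_mul_smul := smul_mon_mul_smul_mon
  lam := lam
  shK_lam a b c i := extKK_shift_lamK _ i
  sub_add_ne_zero := lamK_sub_add_intCast_ne_zero (by decide)
  p₀ := gaugeX 0
  p₁ := gaugeX 1
  p₂ := gaugeX 2
  q₀ := gaugeY 0
  q₁ := gaugeY 1
  q₂ := gaugeY 2
  toK_p₀ := toKK_gaugeX_zero
  toK_p₁ := toKK_gaugeX_one
  toK_p₂ := toKK_gaugeX_two
  toK_q₀ := toKK_gaugeY_zero
  toK_q₁ := toKK_gaugeY_one
  toK_q₂ := toKK_gaugeY_two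

theorem shiftRing_co (f : LL) : shiftRing.co f = rho f := (rho_eq_smul_mon f).symm

theorem X1_eq : X1 = shiftRing.X1 := by
  rw [X1, x_eq]
  simp [mon, ShiftRing.X1, shiftRing, smul_eq]

theorem Y1_eq : Y1 = shiftRing.Y1 := by
  rw [Y1, y_eq]
  simp [mon, ShiftRing.Y1, shiftRing, smul_eq]

theorem X2_eq : X2 = shiftRing.X2 := by
  rw [X2, x_eq, x_eq]
  simp [mon, ShiftRing.X2, shiftRing, smul_eq]

theorem Y2_eq : Y2 = shiftRing.Y2 := by
  rw [Y2, y_eq, y_eq]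
  simp [mon, ShiftRing.Y2, shiftRing, smul_eq]

theorem X3_eq : X3 = shiftRing.X3 := by
  rw [X3, X1_eq, X2_eq]
  rfl

theorem Y3_eq : Y3 = shiftRing.Y3 := by
  rw [Y3, Y1_eq, Y2_eq]
  rfl

theorem H1_eq : H1 = shiftRing.D1 - shiftRing.D2 := by
  refine Eq.trans ?_ (shiftRing.co_sub _ _)
  rw [shiftRing_co, H1, poly]
  congr 1
  simp only [gamma1, gamma2, map_sub, map_add, map_mul, map_one, map_ofNat]
  change 2 * lam 0 - (lam 1 + lam 2 - 1) = lam 0 - (lam 1 + lam 2 - 1 - lam 0)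
  ring

theorem H2_eq : H2 = shiftRing.D2 - shiftRing.D3 := by
  refine Eq.trans ?_ (shiftRing.co_sub _ _)
  rw [shiftRing_co, H2, poly]
  congr 1
  simp only [gamma1, gamma2, gamma31, map_sub, map_add, map_mul, map_one, map_ofNat]
  change 2 * (lam 1 + lam 2 - 1) - lam 0 - (lam 3 + lam 4 + lam 5) =
    lam 1 + lam 2 - 1 - lam 0 - (lam 3 + lam 4 + lam 5 - (lam 1 + lam 2 - 1))
  ring

/-- The representation of the traceless matrices in `𝔄`. -/
noncomputable def toA : sl3 →ₗ⁅ℂ⁆ A := slHom shiftRing.glE shiftRing.lie_glE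

theorem toA_I_smul_F (k : Fin 8) : toA (Complex.I • F k) = T k := by
  have h : toA (Complex.I • F k) = Complex.I • gellMann shiftRing.glE k :=
    (map_smul toA _ _).trans (congrArg _ (slHom_F shiftRing.lie_glE k))
  rw [h]
  refine (shiftRing.I_smul_gellMann_glE k).trans ?_
  simp only [← X1_eq, ← Y1_eq, ← X2_eq, ← Y2_eq, ← X3_eq, ← Y3_eq, ← H1_eq, ← H2_eq]
  rfl

theorem poly_ne_zero {p : Lam} (v : Fin 6 → ℂ) (h : eval v p ≠ 0) : poly p ≠ 0 := by
  intro h0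
  have h1 : algebraMap Lam LL p = 0 := rho_injective (h0.trans (map_zero rho).symm)
  rw [← map_zero (algebraMap Lam LL)] at h1
  rw [algebraMap_LL_injective h1, map_zero] at h
  exact h rfl

theorem H1_ne_zero : H1 ≠ 0 :=
  poly_ne_zero ![1, 0, 0, 0, 0, 0] (by simp [gamma1, gamma2]; norm_num)

theorem H2_ne_zero : H2 ≠ 0 :=
  poly_ne_zero ![1, 0, 0, 0, 0, 0] (by simp [gamma1, gamma2, gamma31]; norm_num)

theorem H1_add_H2_ne_zero : H1 + H2 ≠ 0 := by
  have h : H1 + H2 = poly (2 * gamma1 - gamma2 + (2 * gamma2 - gamma1 - gamma31)) := by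
    simp only [H1, H2, poly, map_add]
  rw [h]
  -- The sum is γ₁ + γ₂ - γ₃⁽¹⁾, which vanishes at the point used for `H1` and `H2`; here λ₁₁ = 2
  -- gives the value 1.
  exact poly_ne_zero ![2, 0, 0, 0, 0, 0] (by simp [gamma1, gamma2, gamma31]; norm_num)

theorem glE_diag_injective (k l : Fin 3) (hkl : k ≠ l) :
    shiftRing.glE k k ≠ shiftRing.glE l l := by
  have h12 : shiftRing.D1 ≠ shiftRing.D2 := fun h =>
    H1_ne_zero (H1_eq.trans (sub_eq_zero.2 h))
  have h23 : shiftRing.D2 ≠ shiftRing.D3 := fun h =>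
    H2_ne_zero (H2_eq.trans (sub_eq_zero.2 h))
  have h13 : shiftRing.D1 ≠ shiftRing.D3 := fun h => by
    apply H1_add_H2_ne_zero
    rw [H1_eq, H2_eq]
    exact (sub_add_sub_cancel _ _ _).trans (sub_eq_zero.2 h)
  fin_cases k <;> fin_cases l
  · exact absurd rfl hkl
  · exact h12
  · exact h13
  · exact h12.symm
  · exact absurd rfl hkl
  · exact h23
  · exact h13.symm
  · exact h23.symm
  · exact absurd rfl hkl

theorem toA_injective : Function.Injective toA :=
  slHom_injective shiftRing.lie_glE glE_diag_injective

theorem range_toA : (toA.range : Set A) = gsu := by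
  have h : (fun k => slHom shiftRing.glE shiftRing.lie_glE (Complex.I • F k)) = T :=
    funext toA_I_smul_F
  have h' := range_slHom shiftRing.lie_glE
  rw [h] at h'
  exact congrArg _ h'.symm

/-- The isomorphism of the traceless matrices with the Lie subalgebra generated by the operators
`T k`. -/
noncomputable def equivGsu : sl3 ≃ₗ⁅ℂ⁆ gsu :=
  (LieEquiv.ofInjective toA toA_injective).trans (LieEquiv.ofEq _ _ range_toA)

/-! ### Casimir values in 𝔄 -/

theorem extend_equivGsu : extend equivGsu = UniversalEnvelopingAlgebra.lift ℂ toA := rfl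

theorem smul_co (c : ℂ) (f : LL) :
    c • shiftRing.co f = shiftRing.co (((algebraMap Lam LL).comp C) c * f) := by
  rw [shiftRing_co, shiftRing_co, RingHom.comp_apply, ← algebraMap_complex_LL,
    ← Algebra.smul_def, map_smul]

theorem extend_quadratic : extend equivGsu (quadratic F) =
    poly (C (1 / 3 : ℂ) * (gamma31 ^ 2 - 3 * gamma32 - 3)) := by
  rw [extend_equivGsu]
  refine (shiftRing.lift_quadratic_glE smul_co).trans ((shiftRing_co _).trans ?_)
  rw [poly]
  congr 1
  simp only [gamma31, gamma32, map_sub, map_add, map_mul, map_pow, map_ofNat]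
  rfl

theorem extend_cubic : extend equivGsu (cubic F) =
    poly (C (1 / 18 : ℂ) * (27 * gamma33 - 9 * gamma32 * gamma31 + 2 * gamma31 ^ 3)) := by
  rw [extend_equivGsu]
  refine (shiftRing.lift_cubic_glE smul_co).trans ((shiftRing_co _).trans ?_)
  rw [poly]
  congr 1
  simp only [gamma31, gamma32, gamma33, map_sub, map_add, map_mul, map_pow, map_ofNat]
  rfl

theorem smul_poly (c : ℂ) (p : Lam) : c • poly p = poly (C c * p) := by
  rw [poly, poly, map_mul, ← algebraMap_complex_LL, ← Algebra.smul_def, map_smul]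

theorem extend_cubic_I_smul : extend equivGsu (cubic fun k => Complex.I • F k) =
    poly (C (Complex.I / 18) *
      (9 * gamma32 * gamma31 - 2 * gamma31 ^ 3 - 27 * gamma33)) := by
  rw [cubic_I_smul_F, map_smul, extend_cubic, smul_poly]
  congr 1
  have h : (C (Complex.I / 18) : Lam) = C Complex.I * C (1 / 18) := by
    rw [← C_mul]
    congr 1
    ring
  rw [h, C_neg]
  ring

end SU3

theorem mainTheorem6 :
    Function.Injective SU3.rho ∧
    ∃ φ : SU3.sl3 ≃ₗ⁅ℂ⁆ SU3.gsu,
      (∀ k : Fin 8, (φ (Complex.I • SU3.F k) : SU3.A) = SU3.T k) ∧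
      SU3.quadratic SU3.F ∈ Subalgebra.center ℂ SU3.U ∧
      SU3.cubic SU3.F ∈ Subalgebra.center ℂ SU3.U ∧
      SU3.extend φ (SU3.quadratic SU3.F) =
        SU3.poly (MvPolynomial.C (1 / 3 : ℂ) *
          (SU3.gamma31 ^ 2 - 3 * SU3.gamma32 - 3)) ∧
      SU3.extend φ (SU3.cubic (fun k => Complex.I • SU3.F k)) =
        SU3.poly (MvPolynomial.C (Complex.I / 18) *
          (9 * SU3.gamma32 * SU3.gamma31 - 2 * SU3.gamma31 ^ 3 - 27 * SU3.gamma33)) ∧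
      SU3.extend φ (SU3.cubic SU3.F) =
        SU3.poly (MvPolynomial.C (1 / 18 : ℂ) *
          (27 * SU3.gamma33 - 9 * SU3.gamma32 * SU3.gamma31 + 2 * SU3.gamma31 ^ 3)) :=
  ⟨SU3.rho_injective, SU3.equivGsu, SU3.toA_I_smul_F, SU3.quadratic_F_mem_center,
    SU3.cubic_F_mem_center, SU3.extend_quadratic, SU3.extend_cubic_I_smul, SU3.extend_cubic⟩
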